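/- Let $G=H\rtimes\mathbb{Z}^n$ be an internal semidirect product ($H$ normal, $x^y:=y^{-1}xy$). A character is a homomorphism to $\mathbb{R}$; it is discrete if its image is cyclic. For a character $\rho:\mathbb{Z}^n\to\mathbb{R}$, a subset $Q\subseteq H$ is $\rho$-confining if $Q=Q^{-1}$; $Q^z\subseteq Q$ whenever $\rho(z)\ge 0$; for every $h\in H$ some $z\in\mathbb{Z}^n$ satisfies $h^z\in Q$; and $(Q\cdot Q)^{z_0}\subseteq Q$ for some $z_0\in\mathbb{Z}^n$. It is strictly $\rho$-confining if moreover $Q^z\subsetneq Q$ for some $z\in\mathbb{Z}^n$. Let $Z_\rho=\{z\in\mathbb{Z}^n : |\rho(z)|\le C_\rho\}$, where $C_\rho>0$ is any value of $\rho$ that bounds $|\rho|$ on some finite generating set of $\mathbb{Z}^n$. A hyperbolic structure $[A]$ on $G$ is given by a generating set $A$ with $\mathrm{Cay}(G,A)$ hyperbolic, and it is represented by a cobounded hyperbolic action $G\curvearrowright X$ if $G\curvearrowright \mathrm{Cay}(G,A)$ and $G\curvearrowright X$ are equivalent, i.e. there are coarsely Lipschitz, coarsely $G$-equivariant maps in both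 directions. (1) Let $\rho:\mathbb{Z}^n\to\mathbb{R}$ be a non-trivial discrete character and let $Q$ be a $\rho$-confining subset that is a subgroup. Then there are elements $a\in\mathbb{Z}^n$ with $\rho(a)$ positive and minimal, $K=Q\ker(\rho)$ is a subgroup of $G$, and for each such $a$ the group $G$ is an ascending HNN-extension with base $K$ and stable letter $a$. Moreover $[Q\cup Z_\rho]$ is a hyperbolic structure, and it is represented by the (simplicial) action of $G$ on the Bass--Serre tree of this HNN-extension. (2) Let $G$ act simplicially and coboundedly on a simplicial tree $X$, and suppose that the action is oriented lineal (exactly two limit points, both fixed by $G$) or quasi-parabolic (infinitely many limit points, and a fixed point in $\partial X$). Let $\xi\in\partial X$ be fixed by $G$ and let $p:G\to\mathbb{R}$ be the corresponding Busemann pseudocharacter, that is, the homogenization $p(g)=\lim_k q(g^k)/k$ of $q(g)=\limsup_m\,(d(x,x_m)-d(gx,x_m))$, where $x\in X$ and $x_m\to\xi$. Suppose that $p$ vanishes on $H$. Then $p$ induces a non-trivial character $\rho:\mathbb{Z}^n\to\mathbb{R}$, $p(hz)=\rho(z)$ for $h\in H$, $z\in\mathbb{Z}^n$, and $\rho$ is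 discrete. Moreover there is a vertex $w$ of $X$ such that the subgroup $Q=\mathrm{Stab}_H(w)$ is $\rho$-confining, $[Q\cup Z_\rho]$ is a hyperbolic structure represented by $G\curvearrowright X$, and $X$ is $G$-equivariantly quasi-isometric to $\mathrm{Cay}(G,Q\cup Z_\rho)$. If the action is oriented lineal, then $Q=H$; if it is quasi-parabolic, then $Q$ is strictly confining. -/

import Mathlib

open Filter Topology
open scoped Pointwise

namespace ConfTree

universe u v w

/-! ### Graphs as metric spaces, and actions on them

A connected graph is regarded as a metric space through its path metric `Γ.dist` on the vertex
set, which is `1/2`-dense in the geometric realization and invariant under all simplicial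
automorphisms. A simplicial action of `G` is a homomorphism from `G` to the group `Γ ≃g Γ` of
graph automorphisms. -/

/-- The Gromov product `(x | y)_o` in the path metric. -/
noncomputable def gromovProduct {V : Type v} (Γ : SimpleGraph V) (o x y : V) : ℝ :=
  ((Γ.dist o x : ℝ) + Γ.dist o y - Γ.dist x y) / 2

/-- Gromov hyperbolicity (four-point condition). -/
def IsHyperbolic {V : Type v} (Γ : SimpleGraph V) : Prop :=
  ∃ δ : ℝ, ∀ o x y z : V,
    min (gromovProduct Γ o x y) (gromovProduct Γ o y z) - δ ≤ gromovProduct Γ o x z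

/-- The sequences `x` and `y` converge to infinity together: `(x_i | y_j)_o → ∞` as `i, j → ∞`
(the choice of the base point `o` is irrelevant). -/
def CoConverge {V : Type v} (Γ : SimpleGraph V) (x y : ℕ → V) : Prop :=
  ∀ o : V, Tendsto (fun p : ℕ × ℕ => gromovProduct Γ o (x p.1) (y p.2)) atTop atTop

/-- The sequences that converge to a point at infinity. -/
def GromovSeq {V : Type v} (Γ : SimpleGraph V) : Type v :=
  {x : ℕ → V // CoConverge Γ x x}

/-- The (sequential) Gromov boundary. On a hyperbolic graph the relation of which the quotient is
taken is already an equivalence relation. -/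
def Boundary {V : Type v} (Γ : SimpleGraph V) : Type v :=
  Quot (fun x y : GromovSeq Γ => CoConverge Γ x.1 y.1)

/-- The sequence `x` of vertices converges to the boundary point `ξ`. -/
def ConvergesTo {V : Type v} {Γ : SimpleGraph V} (x : ℕ → V) (ξ : Boundary Γ) : Prop :=
  ∃ hx : CoConverge Γ x x, (Quot.mk _ (⟨x, hx⟩ : GromovSeq Γ) : Boundary Γ) = ξ

theorem dist_iso {V : Type v} {Γ : SimpleGraph V} (e : Γ ≃g Γ) (x y : V) :
    Γ.dist (e x) (e y) = Γ.dist x y := by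
  have key : ∀ (f : Γ ≃g Γ) (a b : V), Γ.dist (f a) (f b) ≤ Γ.dist a b := by
    intro f a b
    by_cases h : Γ.Reachable a b
    · obtain ⟨p, hp⟩ := h.exists_walk_length_eq_dist
      rw [← hp]
      exact (SimpleGraph.dist_le (p.map f.toHom)).trans (by simp)
    · have h2 : ¬ Γ.Reachable (f a) (f b) := by
        intro h3
        apply h
        have h4 := h3.map f.symm.toHom
        simpa using h4
      rw [SimpleGraph.dist_eq_zero_of_not_reachable h2]
      exact Nat.zero_le _
  refine le_antisymm (key e x y) ?_
  simpa using key e.symm (e x) (e y)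

theorem CoConverge.map {V : Type v} {Γ : SimpleGraph V} (e : Γ ≃g Γ) {x y : ℕ → V}
    (h : CoConverge Γ x y) : CoConverge Γ (fun n => e (x n)) (fun n => e (y n)) := by
  intro o
  have h1 := h (e.symm o)
  refine h1.congr ?_
  intro p
  have h2 : e (e.symm o) = o := e.apply_symm_apply o
  have h3 : ∀ a, Γ.dist o (e a) = Γ.dist (e.symm o) a := by
    intro a
    conv_lhs => rw [← h2]
    exact dist_iso e _ _
  simp only [gromovProduct, h3, dist_iso]

/-- The map induced on the boundary by an automorphism. -/
def boundaryMap {V : Type v} {Γ : SimpleGraph V} (e : Γ ≃g Γ) : Boundary Γ → Boundary Γ :=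
  Quot.map (fun x => ⟨fun n => e (x.1 n), x.2.map e⟩) (fun _ _ h => h.map e)

/-- `G` fixes the boundary point `ξ`. -/
def FixesPoint {G : Type u} [Group G] {V : Type v} {Γ : SimpleGraph V} (α : G →* (Γ ≃g Γ))
    (ξ : Boundary Γ) : Prop :=
  ∀ g : G, boundaryMap (α g) ξ = ξ

/-- The limit set `Λ(G)`: all boundary points that are limits of sequences in an orbit. -/
def limitSet {G : Type u} [Group G] {V : Type v} {Γ : SimpleGraph V} (α : G →* (Γ ≃g Γ)) :
    Set (Boundary Γ) :=
  {ξ | ∃ (x : V) (g : ℕ → G), ConvergesTo (fun n => α (g n) x) ξ}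

/-- Oriented lineal: there are exactly two limit points, and both are fixed. -/
def IsOrientedLineal {G : Type u} [Group G] {V : Type v} {Γ : SimpleGraph V}
    (α : G →* (Γ ≃g Γ)) : Prop :=
  (limitSet α).encard = 2 ∧ ∀ ξ ∈ limitSet α, FixesPoint α ξ

/-- Quasi-parabolic: there are infinitely many limit points, and some boundary point is fixed. -/
def IsQuasiParabolic {G : Type u} [Group G] {V : Type v} {Γ : SimpleGraph V}
    (α : G →* (Γ ≃g Γ)) : Prop :=
  (limitSet α).Infinite ∧ ∃ ξ : Boundary Γ, FixesPoint α ξ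

/-- Cobounded: some bounded set meets every orbit. -/
def IsCobounded {G : Type u} [Group G] {V : Type v} {Γ : SimpleGraph V}
    (α : G →* (Γ ≃g Γ)) : Prop :=
  ∃ (x : V) (R : ℕ), ∀ y : V, ∃ g : G, Γ.dist (α g x) y ≤ R

/-! ### The Busemann pseudocharacter -/

/-- The Busemann quasimorphism `g ↦ limsup (d(x, xₙ) - d(gx, xₙ))`. -/
noncomputable def busemannQuasimorphism {G : Type u} [Group G] {V : Type v} {Γ : SimpleGraph V}
    (α : G →* (Γ ≃g Γ)) (x : V) (xs : ℕ → V) (g : G) : ℝ :=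
  limsup (fun n : ℕ => (Γ.dist x (xs n) : ℝ) - Γ.dist (α g x) (xs n)) atTop

/-- The homogenization `g ↦ lim q(gⁿ)/n` of a quasimorphism `q`. -/
noncomputable def homogenization {G : Type u} [Group G] (q : G → ℝ) (g : G) : ℝ :=
  limUnder atTop (fun n : ℕ => q (g ^ n) / n)

/-- The Busemann pseudocharacter at the boundary point to which `xs` converges. -/
noncomputable def busemann {G : Type u} [Group G] {V : Type v} {Γ : SimpleGraph V}
    (α : G →* (Γ ≃g Γ)) (x : V) (xs : ℕ → V) : G → ℝ :=
  homogenization (busemannQuasimorphism α x xs)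

/-! ### The order on hyperbolic actions, and hyperbolic structures -/

/-- `f` is coarsely Lipschitz. -/
def IsCoarselyLipschitz {V : Type v} {W : Type w} (Γ : SimpleGraph V) (Δ : SimpleGraph W)
    (f : V → W) : Prop :=
  ∃ L : ℝ, ∀ x y : V, (Δ.dist (f x) (f y) : ℝ) ≤ L * Γ.dist x y + L

/-- `f` is coarsely `G`-equivariant. -/
def IsCoarselyEquivariant {G : Type u} [Group G] {V : Type v} {W : Type w} {Γ : SimpleGraph V}
    {Δ : SimpleGraph W} (α : G →* (Γ ≃g Γ)) (β : G →* (Δ ≃g Δ)) (f : V → W) : Prop :=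
  ∀ x : V, ∃ C : ℝ, ∀ g : G, (Δ.dist (f (α g x)) (β g (f x)) : ℝ) ≤ C

/-- `β` is dominated by `α`. -/
def IsDominatedBy {G : Type u} [Group G] {V : Type v} {W : Type w} {Γ : SimpleGraph V}
    {Δ : SimpleGraph W} (β : G →* (Δ ≃g Δ)) (α : G →* (Γ ≃g Γ)) : Prop :=
  ∃ f : V → W, IsCoarselyLipschitz Γ Δ f ∧ IsCoarselyEquivariant α β f

/-- Equivalence of actions: each dominates the other. -/
def IsEquivalent {G : Type u} [Group G] {V : Type v} {W : Type w} {Γ : SimpleGraph V}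
    {Δ : SimpleGraph W} (α : G →* (Γ ≃g Γ)) (β : G →* (Δ ≃g Δ)) : Prop :=
  IsDominatedBy α β ∧ IsDominatedBy β α

/-- There is a `G`-equivariant quasi-isometry. -/
def IsEquivariantlyQuasiIsometric {G : Type u} [Group G] {V : Type v} {W : Type w}
    {Γ : SimpleGraph V} {Δ : SimpleGraph W} (α : G →* (Γ ≃g Γ)) (β : G →* (Δ ≃g Δ)) : Prop :=
  ∃ f : V → W, (∀ (g : G) (x : V), f (α g x) = β g (f x)) ∧
    ∃ L : ℝ, 1 ≤ L ∧
      (∀ x y : V, (Δ.dist (f x) (f y) : ℝ) ≤ L * Γ.dist x y + L) ∧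
      (∀ x y : V, (Γ.dist x y : ℝ) / L - L ≤ Δ.dist (f x) (f y)) ∧
      ∀ y : W, ∃ x : V, (Δ.dist (f x) y : ℝ) ≤ L

/-- The action of `G` by left multiplication on its Cayley graph with respect to `A`. -/
def cayleyAction {G : Type u} [Group G] (A : Set G) :
    G →* (SimpleGraph.mulCayley A ≃g SimpleGraph.mulCayley A) where
  toFun g := ⟨Equiv.mulLeft g, by intro a b; simp [SimpleGraph.mulCayley_adj', mul_assoc]⟩
  map_one' := by ext x; simp
  map_mul' g h := by ext x; simp

/-- `[A]` is a hyperbolic structure: `A` generates `G` and `Cay(G, A)` is hyperbolic. -/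
def IsHyperbolicStructure {G : Type u} [Group G] (A : Set G) : Prop :=
  Subgroup.closure A = ⊤ ∧ IsHyperbolic (SimpleGraph.mulCayley A)

/-- The hyperbolic structure `[A]` is represented by the cobounded hyperbolic action `α`:
the actions on `Cay(G, A)` and on `Γ` are equivalent. -/
def IsRepresentedBy {G : Type u} [Group G] {V : Type v} {Γ : SimpleGraph V} (A : Set G)
    (α : G →* (Γ ≃g Γ)) : Prop :=
  IsHyperbolicStructure A ∧ Γ.Connected ∧ IsHyperbolic Γ ∧ IsCobounded α ∧
    IsEquivalent (cayleyAction A) α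

/-! ### Characters and confining subsets of `G = H ⋊ ℤⁿ`

The semidirect product is internal: `H` is a normal subgroup of `G`, and `Z` is a complement of
`H`, isomorphic to `ℤⁿ`. A character of `Z` is a homomorphism `ρ : Z →* Multiplicative ℝ`, and
`(ρ z).toAdd` is its real value at `z`. -/

/-- A character is discrete if its image is cyclic. -/
def IsDiscrete {K : Type u} [Group K] (ρ : K →* Multiplicative ℝ) : Prop :=
  IsCyclic ρ.range

/-- The kernel of `ρ`, as a subgroup of `G`. -/
def kerIn {G : Type u} [Group G] {Z : Subgroup G} (ρ : Z →* Multiplicative ℝ) : Subgroup G :=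
  ρ.ker.map Z.subtype

/-- `Q` is a `ρ`-confining subset of `H`; here `q ^ z` is `z⁻¹ q z`. -/
structure IsConfining {G : Type u} [Group G] (H Z : Subgroup G) (ρ : Z →* Multiplicative ℝ)
    (Q : Set G) : Prop where
  subset : Q ⊆ H
  symmetric : ∀ q ∈ Q, q⁻¹ ∈ Q
  stays : ∀ z : Z, 0 ≤ (ρ z).toAdd → ∀ q ∈ Q, (z : G)⁻¹ * q * z ∈ Q
  gets_in : ∀ h ∈ H, ∃ z : Z, (z : G)⁻¹ * h * z ∈ Q
  products : ∃ z : Z, ∀ q ∈ Q, ∀ r ∈ Q, (z : G)⁻¹ * (q * r) * z ∈ Q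

/-- `Q` is strictly `ρ`-confining: moreover `Q ^ z` is properly contained in `Q` for some `z`. -/
def IsStrictlyConfining {G : Type u} [Group G] (H Z : Subgroup G) (ρ : Z →* Multiplicative ℝ)
    (Q : Set G) : Prop :=
  IsConfining H Z ρ Q ∧ ∃ z : Z, (fun q => (z : G)⁻¹ * q * z) '' Q ⊂ Q

/-- The constants `C_ρ` allowed in the construction of `Z_ρ`: positive values of `ρ` that bound
`|ρ|` on some finite generating set of `Z`. -/
def IsAdmissible {G : Type u} [Group G] {Z : Subgroup G} (ρ : Z →* Multiplicative ℝ) (C : ℝ) :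
    Prop :=
  0 < C ∧ (∃ S : Set Z, S.Finite ∧ Subgroup.closure S = ⊤ ∧ ∀ s ∈ S, |(ρ s).toAdd| ≤ C) ∧
    ∃ z : Z, (ρ z).toAdd = C

/-- The set `Z_ρ = {z ∈ ℤⁿ | |ρ(z)| ≤ C}`. -/
def slab {G : Type u} [Group G] {Z : Subgroup G} (ρ : Z →* Multiplicative ℝ) (C : ℝ) : Set G :=
  {g | ∃ z : Z, (z : G) = g ∧ |(ρ z).toAdd| ≤ C}

/-- `ρ(a)` is positive and minimal among the positive values of `ρ`. -/
def IsMinimalPositive {G : Type u} [Group G] {Z : Subgroup G} (ρ : Z →* Multiplicative ℝ)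
    (a : Z) : Prop :=
  0 < (ρ a).toAdd ∧ ∀ z : Z, 0 < (ρ z).toAdd → (ρ a).toAdd ≤ (ρ z).toAdd

/-! ### Ascending HNN-extensions and their Bass–Serre trees -/

/-- `G` is the ascending HNN-extension with base `K` and stable letter `a`: it has the presentation
`⟨K, t | t x t⁻¹ = φ x for x ∈ A⟩`, with `t` equal to `a`, where `A` is a subgroup of `K` and
`φ : A → K` is an isomorphism onto `K`. Thus `A = a⁻¹ K a ≤ K`. -/
def IsAscendingHNN {G : Type u} [Group G] (K : Subgroup G) (a : G) : Prop :=
  ∃ (A : Subgroup K) (φ : A ≃* (⊤ : Subgroup K)) (Φ : HNNExtension K A ⊤ φ ≃* G),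
    (∀ k : K, Φ (HNNExtension.of k) = k) ∧ Φ HNNExtension.t = a

/-- The Bass–Serre tree of an HNN-extension with base `K` and stable letter `a`: the vertices are
the cosets `gK`, and there is an edge from `gK` to `gaK` for every `g`. -/
def bassSerre {G : Type u} [Group G] (K : Subgroup G) (a : G) : SimpleGraph (G ⧸ K) :=
  SimpleGraph.fromRel (fun x y => ∃ g : G, x = (g : G ⧸ K) ∧ y = ((g * a : G) : G ⧸ K))

theorem bassSerre_rel_smul {G : Type u} [Group G] (K : Subgroup G) (a g : G) (x y : G ⧸ K) :
    (∃ k : G, g • x = (k : G ⧸ K) ∧ g • y = ((k * a : G) : G ⧸ K)) ↔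
      ∃ k : G, x = (k : G ⧸ K) ∧ y = ((k * a : G) : G ⧸ K) := by
  constructor
  · rintro ⟨k, h1, h2⟩
    refine ⟨g⁻¹ * k, ?_, ?_⟩
    · rw [eq_comm, ← inv_smul_eq_iff.mpr h1.symm]; rfl
    · rw [eq_comm, ← inv_smul_eq_iff.mpr h2.symm, mul_assoc]; rfl
  · rintro ⟨k, rfl, rfl⟩
    exact ⟨g * k, rfl, by rw [mul_assoc]; rfl⟩

/-- The action of `G` on the Bass–Serre tree by left multiplication. -/
def bassSerreAction {G : Type u} [Group G] (K : Subgroup G) (a : G) :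
    G →* (bassSerre K a ≃g bassSerre K a) where
  toFun g := ⟨MulAction.toPerm g, by
    intro x y
    simp only [bassSerre, SimpleGraph.fromRel_adj, MulAction.toPerm_apply, ne_eq,
      smul_left_cancel_iff, bassSerre_rel_smul]⟩
  map_one' := by ext x; exact one_smul G x
  map_mul' g h := by ext x; exact mul_smul g h x

/-- The stabilizer in `H` of the vertex `x`. -/
def vertexStabilizer {G : Type u} [Group G] {V : Type v} {Γ : SimpleGraph V}
    (α : G →* (Γ ≃g Γ)) (H : Subgroup G) (x : V) : Subgroup G where
  carrier := {g | g ∈ H ∧ α g x = x}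
  one_mem' := ⟨H.one_mem, by simp⟩
  mul_mem' := by
    rintro g h ⟨hg, hg'⟩ ⟨hh, hh'⟩
    refine ⟨H.mul_mem hg hh, ?_⟩
    rw [map_mul, RelIso.mul_apply, hh', hg']
  inv_mem' := by
    rintro g ⟨hg, hg'⟩
    refine ⟨H.inv_mem hg, ?_⟩
    have h : α g⁻¹ (α g x) = x := by
      rw [← RelIso.mul_apply, ← map_mul, inv_mul_cancel, map_one, RelIso.one_apply]
    rwa [hg'] at h

end ConfTree

open ConfTree

namespace ConfTree

universe u v w

/-! ### Graphs given by a parent function -/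

/-! Both halves rest on one picture: a tree with a distinguished end `ξ`, encoded by a parent
function `P` (one step towards `ξ`) and an integer height `ht` (the Busemann function). The distance
of two vertices is the number of steps that both need to climb to their first common ancestor. Hence
the height of the meet is an ultrametric, and the four-point condition holds with `δ = 0`.

`IsAxial` adds an action that commutes with `P`, shifts heights by a homomorphism `c` that vanishes
on `H`, and has a base vertex `w` with `z w = P^[c z] w` for `z ∈ Z`, `c z ≥ 0`. For `Q = Stab_H(w)`
and the slab `|c| ≤ m`, the orbit map `g ↦ g w` on the Cayley graph then multiplies distances by `m`
up to the additive error `5 * m` (`exists_hasWordLength`): climb from `w` past the meet with `g w`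
along the axis, then come down by an element of `Z`; the discrepancy fixes `w` and is a product of
two generators. Hyperbolicity of the Cayley graph, equivalence of the actions and the equivariant
quasi-isometry all follow (`IsAxial.isRepresentedBy`).

For (1), `K = Q ker ρ` satisfies `a⁻¹ K a ≤ K`, and every `g` lies in some `a ^ i K (a ^ j)⁻¹`. This
gives the HNN presentation by normal forms, and makes the coset graph ancestral under `gK ↦ gaK`.
The stabilizer in `H` of the coset `K` is `Q`, so the axial machinery applies.

For (2), the step from a vertex towards `ξ` is eventually constant along a sequence converging to
`ξ`, so the Busemann quasimorphism is already an integer-valued homomorphism `c`. Coboundedness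
makes `c` non-trivial. The rays from `x` and `b x` merge if `c b > 0`, which yields a vertex on the
axis of `b`; since `Z` is abelian, all of `Z` translates along this axis. Stabilizers grow along the
ray, so `Q` is confining. If the opposite end of the axis is fixed, nothing can branch off and `Q =
H`; if conjugation by `b` maps `Q` onto itself, `H` fixes `w` and the limit set is finite. -/

/-- `Γ` is the graph of the parent function `P`, along which the height `ht` increases by one, and
any two vertices have a common ancestor. Thus `Γ` is a tree with a distinguished end. -/
structure IsAncestral {V : Type v} (Γ : SimpleGraph V) (P : V → V) (ht : V → ℤ) : Prop where
  adj_iff : ∀ u v, Γ.Adj u v ↔ P u = v ∨ P v = u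
  ht_parent : ∀ v, ht (P v) = ht v + 1
  common : ∀ u v, ∃ i j : ℕ, P^[i] u = P^[j] v

namespace IsAncestral

variable {V : Type v} {Γ : SimpleGraph V} {P : V → V} {ht : V → ℤ}

theorem ht_iterate (h : IsAncestral Γ P ht) (k : ℕ) (v : V) : ht (P^[k] v) = ht v + k := by
  induction k generalizing v with
  | zero => simp
  | succ k ih => rw [Function.iterate_succ_apply, ih, h.ht_parent]; push_cast; ring

theorem adj_parent (h : IsAncestral Γ P ht) (v : V) : Γ.Adj v (P v) :=
  (h.adj_iff _ _).2 (Or.inl rfl)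

theorem exists_walk_iterate (h : IsAncestral Γ P ht) (k : ℕ) (v : V) :
    ∃ p : Γ.Walk v (P^[k] v), p.length = k := by
  induction k generalizing v with
  | zero => exact ⟨.nil, rfl⟩
  | succ k ih =>
    obtain ⟨p, hp⟩ := ih (P v)
    exact ⟨.cons (h.adj_parent v) p, by simp [hp]⟩

theorem preconnected (h : IsAncestral Γ P ht) : Γ.Preconnected := by
  intro u v
  obtain ⟨i, j, hij⟩ := h.common u v
  obtain ⟨p, -⟩ := h.exists_walk_iterate i u
  obtain ⟨q, -⟩ := h.exists_walk_iterate j v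
  rw [hij] at p
  exact ⟨p.append q.reverse⟩

theorem dist_le_of_iterate_eq (h : IsAncestral Γ P ht) {u v : V} {i j : ℕ}
    (hij : P^[i] u = P^[j] v) : Γ.dist u v ≤ i + j := by
  obtain ⟨p, hp⟩ := h.exists_walk_iterate i u
  obtain ⟨q, hq⟩ := h.exists_walk_iterate j v
  calc Γ.dist u v ≤ (p.append (q.copy rfl hij.symm).reverse).length := SimpleGraph.dist_le _
    _ = i + j := by simp [hp, hq]

/-- Induct from the front of the walk. An upward first edge adds one to `i`. A downward one cancels
the first step of the ascent, or, if there is no ascent, adds one to `j`. Thus backtracking never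
lowers the cost below `i + j`, which makes up-then-down paths geodesic. -/
theorem exists_iterate_eq_of_walk (h : IsAncestral Γ P ht) {u v : V} (p : Γ.Walk u v) :
    ∃ i j : ℕ, P^[i] u = P^[j] v ∧ i + j ≤ p.length := by
  induction p with
  | nil => exact ⟨0, 0, rfl, le_rfl⟩
  | cons hadj p ih =>
    obtain ⟨i, j, hij, hle⟩ := ih
    rcases (h.adj_iff _ _).1 hadj with h1 | h1
    · refine ⟨i + 1, j, ?_, ?_⟩
      · rw [Function.iterate_succ_apply, h1, hij]
      · rw [SimpleGraph.Walk.length_cons]; omega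
    · rcases i with _ | i
      · refine ⟨0, j + 1, ?_, ?_⟩
        · rw [Function.iterate_succ_apply', ← hij]; exact h1.symm
        · rw [SimpleGraph.Walk.length_cons]; omega
      · refine ⟨i, j, ?_, ?_⟩
        · rw [← hij, Function.iterate_succ_apply, h1]
        · rw [SimpleGraph.Walk.length_cons]; omega

theorem exists_iterate_eq_dist (h : IsAncestral Γ P ht) (u v : V) :
    ∃ i j : ℕ, P^[i] u = P^[j] v ∧ i + j = Γ.dist u v := by
  obtain ⟨p, hp⟩ := (h.preconnected u v).exists_walk_length_eq_dist
  obtain ⟨i, j, hij, hle⟩ := h.exists_iterate_eq_of_walk p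
  exact ⟨i, j, hij, le_antisymm (hp ▸ hle) (h.dist_le_of_iterate_eq hij)⟩

theorem abs_ht_sub_le_dist (h : IsAncestral Γ P ht) (u v : V) :
    |ht u - ht v| ≤ Γ.dist u v := by
  obtain ⟨i, j, hij, hd⟩ := h.exists_iterate_eq_dist u v
  have h1 := congrArg ht hij
  rw [h.ht_iterate, h.ht_iterate] at h1
  rw [abs_le]
  omega

theorem dist_iterate (h : IsAncestral Γ P ht) (k : ℕ) (v : V) : Γ.dist v (P^[k] v) = k := by
  have h1 : Γ.dist v (P^[k] v) ≤ k + 0 := h.dist_le_of_iterate_eq rfl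
  have h2 := h.abs_ht_sub_le_dist v (P^[k] v)
  rw [h.ht_iterate, abs_le] at h2
  omega

/-- The height of the meet of two vertices is an ultrametric. -/
theorem dist_add_ht_le_max (h : IsAncestral Γ P ht) (x y z : V) :
    (Γ.dist x z : ℤ) + ht x + ht z ≤
      max ((Γ.dist x y : ℤ) + ht x + ht y) ((Γ.dist y z : ℤ) + ht y + ht z) := by
  obtain ⟨i, j, hij, hd⟩ := h.exists_iterate_eq_dist x y
  obtain ⟨k, l, hkl, hd'⟩ := h.exists_iterate_eq_dist y z
  have h1 := congrArg ht hij
  have h2 := congrArg ht hkl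
  rw [h.ht_iterate, h.ht_iterate] at h1 h2
  rcases le_total j k with hjk | hjk
  · have h3 : P^[k - j + i] x = P^[l] z := by
      rw [Function.iterate_add_apply, hij, ← Function.iterate_add_apply, Nat.sub_add_cancel hjk,
        hkl]
    have h4 := h.dist_le_of_iterate_eq h3
    refine le_max_of_le_right ?_
    omega
  · have h3 : P^[i] x = P^[j - k + l] z := by
      rw [hij, Function.iterate_add_apply, ← hkl, ← Function.iterate_add_apply,
        Nat.sub_add_cancel hjk]
    have h4 := h.dist_le_of_iterate_eq h3
    refine le_max_of_le_left ?_
    omega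

/-- The quantity `dist x y + ht x + ht y` is twice the height of the meet. In the sums over the two
pairs of an opposite pairing all four heights occur once, so they cancel, and only the ultrametric
inequality is needed. -/
theorem four_point (h : IsAncestral Γ P ht) (o x y z : V) :
    Γ.dist o y + Γ.dist x z ≤
      max (Γ.dist o x + Γ.dist y z) (Γ.dist o z + Γ.dist x y) := by
  have h1 := h.dist_add_ht_le_max o x y
  have h2 := h.dist_add_ht_le_max o z y
  have h3 := h.dist_add_ht_le_max x o z
  have h4 := h.dist_add_ht_le_max x y z
  rw [Γ.dist_comm (u := z) (v := y)] at h2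
  rw [Γ.dist_comm (u := x) (v := o)] at h3
  rw [le_max_iff] at *
  omega

theorem min_gromovProduct_le (h : IsAncestral Γ P ht) (o x y z : V) :
    min (gromovProduct Γ o x y) (gromovProduct Γ o y z) ≤ gromovProduct Γ o x z := by
  have h1 := h.four_point o x y z
  have h2 : (Γ.dist o y : ℝ) + Γ.dist x z ≤
      max ((Γ.dist o x : ℝ) + Γ.dist y z) (Γ.dist o z + Γ.dist x y) := by exact_mod_cast h1
  simp only [gromovProduct]
  rw [le_max_iff] at h2
  rw [min_le_iff]
  rcases h2 with h2 | h2
  · right; linarith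
  · left; linarith

theorem isHyperbolic (h : IsAncestral Γ P ht) : IsHyperbolic Γ :=
  ⟨0, fun o x y z => by simpa using h.min_gromovProduct_le o x y z⟩

theorem isTree [Nonempty V] (h : IsAncestral Γ P ht) : Γ.IsTree := by
  have key : ∀ v : V, ¬ (Γ.deleteEdges {s(v, P v)}).Reachable v (P v) := by
    intro v hr
    -- Without the edge from `v` to `P v`, the set of descendants of `v` cannot be left. It contains
    -- `v` but, by height, not `P v`, so this edge is a bridge.
    have inv : ∀ u w : V, (Γ.deleteEdges {s(v, P v)}).Reachable u w →
        (∃ k : ℕ, P^[k] u = v) → ∃ k : ℕ, P^[k] w = v := by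
      rintro u w ⟨p⟩ hu
      induction p with
      | nil => exact hu
      | cons hadj p ih =>
        rename_i a b c
        apply ih
        rw [SimpleGraph.deleteEdges_adj, Set.mem_singleton_iff] at hadj
        obtain ⟨hadj, hne⟩ := hadj
        obtain ⟨k, hk⟩ := hu
        rcases (h.adj_iff _ _).1 hadj with h1 | h1
        · rcases k with _ | k
          · exfalso
            apply hne
            have h2 : a = v := hk
            rw [← h1, h2]
          · exact ⟨k, by rw [← h1, ← Function.iterate_succ_apply, hk]⟩
        · exact ⟨k + 1, by rw [Function.iterate_succ_apply, h1, hk]⟩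
    obtain ⟨k, hk⟩ := inv _ _ hr ⟨0, rfl⟩
    have h1 := congrArg ht hk
    rw [h.ht_iterate, h.ht_parent] at h1
    omega
  refine ⟨⟨h.preconnected⟩, ?_⟩
  rw [SimpleGraph.isAcyclic_iff_forall_adj_isBridge]
  intro u v hadj
  rw [SimpleGraph.isBridge_iff]
  rcases (h.adj_iff _ _).1 hadj with rfl | rfl
  · exact key u
  · intro hr
    rw [Sym2.eq_swap] at hr
    exact key v hr.symm

end IsAncestral

/-! ### Word length -/

section WordLength

variable {G : Type u} [Group G] {A : Set G}

/-- `g` is a product of at most `n` elements of `A ∪ A⁻¹`. -/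
def HasWordLength (A : Set G) (g : G) (n : ℕ) : Prop :=
  ∃ p : (SimpleGraph.mulCayley A).Walk 1 g, p.length ≤ n

theorem HasWordLength.mono {g : G} {a b : ℕ} (h : HasWordLength A g a) (hab : a ≤ b) :
    HasWordLength A g b := by
  obtain ⟨p, hp⟩ := h
  exact ⟨p, hp.trans hab⟩

theorem cayleyAction_apply (g x : G) : cayleyAction A g x = g * x := rfl

theorem exists_walk_mul_left (g : G) {x y : G} (p : (SimpleGraph.mulCayley A).Walk x y) :
    ∃ q : (SimpleGraph.mulCayley A).Walk (g * x) (g * y), q.length = p.length :=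
  ⟨p.map (cayleyAction A g).toHom, SimpleGraph.Walk.length_map _ _⟩

theorem HasWordLength.mul {g g' : G} {a b : ℕ} (h : HasWordLength A g a)
    (h' : HasWordLength A g' b) : HasWordLength A (g * g') (a + b) := by
  obtain ⟨p, hp⟩ := h
  obtain ⟨q, hq⟩ := h'
  obtain ⟨q', hq'⟩ := exists_walk_mul_left g q
  refine ⟨p.append (q'.copy (mul_one g) rfl), ?_⟩
  rw [SimpleGraph.Walk.length_append, SimpleGraph.Walk.length_copy]
  omega

theorem HasWordLength.inv {g : G} {a : ℕ} (h : HasWordLength A g a) :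
    HasWordLength A g⁻¹ a := by
  obtain ⟨p, hp⟩ := h
  obtain ⟨q, hq⟩ := exists_walk_mul_left g⁻¹ p
  refine ⟨(q.copy (mul_one g⁻¹) (inv_mul_cancel g)).reverse, ?_⟩
  rw [SimpleGraph.Walk.length_reverse, SimpleGraph.Walk.length_copy, hq]
  exact hp

theorem hasWordLength_one_of_mem {g : G} (h : g ∈ A) : HasWordLength A g 1 := by
  by_cases h1 : 1 = g
  · subst h1
    exact ⟨.nil, Nat.zero_le _⟩
  · have hadj : (SimpleGraph.mulCayley A).Adj 1 g := by
      rw [SimpleGraph.mulCayley_adj']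
      exact ⟨h1, g, h, Or.inl (one_mul g)⟩
    exact ⟨hadj.toWalk, by simp⟩

theorem HasWordLength.exists_walk {x y : G} {n : ℕ} (h : HasWordLength A (x⁻¹ * y) n) :
    ∃ p : (SimpleGraph.mulCayley A).Walk x y, p.length ≤ n := by
  obtain ⟨p, hp⟩ := h
  obtain ⟨q, hq⟩ := exists_walk_mul_left x p
  refine ⟨q.copy (mul_one x) (mul_inv_cancel_left x y), ?_⟩
  rw [SimpleGraph.Walk.length_copy, hq]
  exact hp

theorem HasWordLength.reachable {x y : G} {n : ℕ} (h : HasWordLength A (x⁻¹ * y) n) :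
    (SimpleGraph.mulCayley A).Reachable x y := by
  obtain ⟨p, -⟩ := h.exists_walk
  exact ⟨p⟩

theorem HasWordLength.dist_le {x y : G} {n : ℕ} (h : HasWordLength A (x⁻¹ * y) n) :
    (SimpleGraph.mulCayley A).dist x y ≤ n := by
  obtain ⟨p, hp⟩ := h.exists_walk
  exact (SimpleGraph.dist_le p).trans hp

theorem closure_eq_top_of_preconnected (h : (SimpleGraph.mulCayley A).Preconnected) :
    Subgroup.closure A = ⊤ := by
  rw [eq_top_iff]
  rintro g -
  have key : ∀ x y : G, (SimpleGraph.mulCayley A).Walk x y → x ∈ Subgroup.closure A →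
      y ∈ Subgroup.closure A := by
    intro x y p hx
    induction p with
    | nil => exact hx
    | cons hadj p ih =>
      apply ih
      rw [SimpleGraph.mulCayley_adj'] at hadj
      obtain ⟨-, a, ha, h1 | h1⟩ := hadj
      · rw [← h1]
        exact mul_mem hx (Subgroup.subset_closure ha)
      · rw [h1] at hx
        exact (Subgroup.mul_mem_cancel_right _ (Subgroup.subset_closure ha)).1 hx
  obtain ⟨p⟩ := h 1 g
  exact key 1 g p (one_mem _)

end WordLength

/-! ### Axial actions: orbit distance against word length -/

/-- The action `α` preserves the parent function `P` and shifts the height through `c`, which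
vanishes on `H`, while the elements of `Z` with `c z ≥ 0` move `w` to its ancestors. -/
structure IsAxial {G : Type u} [Group G] (H Z : Subgroup G) {V : Type v} {Γ : SimpleGraph V}
    (α : G →* (Γ ≃g Γ)) (P : V → V) (ht : V → ℤ) (c : G → ℤ) (w : V) : Prop where
  ancestral : IsAncestral Γ P ht
  map_parent : ∀ g v, α g (P v) = P (α g v)
  ht_map : ∀ g v, ht (α g v) = ht v + c g
  eq_zero : ∀ h ∈ H, c h = 0
  axis : ∀ z ∈ Z, ∀ k : ℕ, c z = k → α z w = P^[k] w

theorem map_iterate_of_comm {V : Type v} {P f : V → V} (h : ∀ v, f (P v) = P (f v)) (k : ℕ)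
    (v : V) : f (P^[k] v) = P^[k] (f v) :=
  (Function.Semiconj.iterate_right (f := f) (ga := P) (gb := P) h k) v

namespace IsAxial

variable {G : Type u} [Group G] {H Z : Subgroup G} {V : Type v} {Γ : SimpleGraph V}
  {α : G →* (Γ ≃g Γ)} {P : V → V} {ht : V → ℤ} {c : G → ℤ} {w : V}

theorem map_mul (h : IsAxial H Z α P ht c w) (g g' : G) : c (g * g') = c g + c g' := by
  have h1 := h.ht_map (g * g') w
  rw [_root_.map_mul, RelIso.mul_apply, h.ht_map, h.ht_map] at h1
  omega

theorem map_one (h : IsAxial H Z α P ht c w) : c 1 = 0 := by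
  have h1 := h.map_mul 1 1
  rw [mul_one] at h1
  omega

theorem map_inv (h : IsAxial H Z α P ht c w) (g : G) : c g⁻¹ = - c g := by
  have h1 := h.map_mul g g⁻¹
  rw [mul_inv_cancel, h.map_one] at h1
  omega

theorem map_pow (h : IsAxial H Z α P ht c w) (g : G) (k : ℕ) : c (g ^ k) = k * c g := by
  induction k with
  | zero => simp [h.map_one]
  | succ k ih => rw [pow_succ, h.map_mul, ih]; push_cast; ring

theorem map_iterate (h : IsAxial H Z α P ht c w) (g : G) (k : ℕ) (v : V) :
    α g (P^[k] v) = P^[k] (α g v) :=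
  map_iterate_of_comm (h.map_parent g) k v

theorem apply_inv_apply (α : G →* (Γ ≃g Γ)) (g : G) (v : V) : α g (α g⁻¹ v) = v := by
  rw [← RelIso.mul_apply, ← _root_.map_mul, mul_inv_cancel, _root_.map_one, RelIso.one_apply]

theorem inv_apply_apply (α : G →* (Γ ≃g Γ)) (g : G) (v : V) : α g⁻¹ (α g v) = v := by
  rw [← RelIso.mul_apply, ← _root_.map_mul, inv_mul_cancel, _root_.map_one, RelIso.one_apply]

theorem dist_apply_left (α : G →* (Γ ≃g Γ)) (g : G) (x y : V) :
    Γ.dist (α g x) y = Γ.dist x (α g⁻¹ y) := by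
  conv_lhs => rw [← apply_inv_apply α g y]
  exact dist_iso _ _ _

theorem dist_axis (h : IsAxial H Z α P ht c w) {z : G} (hz : z ∈ Z) :
    (Γ.dist w (α z w) : ℤ) = |c z| := by
  rcases le_total 0 (c z) with h0 | h0
  · obtain ⟨k, hk⟩ := Int.eq_ofNat_of_zero_le h0
    rw [h.axis z hz k hk, h.ancestral.dist_iterate, hk, Nat.abs_cast]
  · have h1 : 0 ≤ c z⁻¹ := by rw [h.map_inv]; omega
    obtain ⟨k, hk⟩ := Int.eq_ofNat_of_zero_le h1
    rw [Γ.dist_comm, dist_apply_left, h.axis z⁻¹ (inv_mem hz) k hk, h.ancestral.dist_iterate,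
      ← abs_neg, ← h.map_inv, hk, Nat.abs_cast]

theorem dist_le_mul_length (h : IsAxial H Z α P ht c w) {A : Set G} {m : ℕ}
    (hA : ∀ a ∈ A, a ∈ vertexStabilizer α H w ∨ a ∈ Z ∧ |c a| ≤ m) {x y : G}
    (p : (SimpleGraph.mulCayley A).Walk x y) :
    Γ.dist (α x w) (α y w) ≤ m * p.length := by
  have key : ∀ a ∈ A, Γ.dist w (α a w) ≤ m := by
    intro a ha
    rcases hA a ha with ⟨-, h1⟩ | ⟨h1, h2⟩
    · rw [h1]; simp
    · rw [← h.dist_axis h1] at h2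
      exact_mod_cast h2
  have hconn := h.ancestral.preconnected
  induction p with
  | nil => simp
  | cons hadj p ih =>
    rename_i x y z
    have h1 : Γ.dist (α x w) (α y w) ≤ m := by
      rw [SimpleGraph.mulCayley_adj'] at hadj
      obtain ⟨-, a, ha, rfl | rfl⟩ := hadj
      · rw [_root_.map_mul, RelIso.mul_apply, dist_iso]
        exact key a ha
      · rw [_root_.map_mul, RelIso.mul_apply, dist_iso, Γ.dist_comm]
        exact key a ha
    have h2 := (hconn (α x w) (α y w)).dist_triangle_left (α z w)
    rw [SimpleGraph.Walk.length_cons, mul_add, mul_one]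
    omega

/-- Multiplying by `e` or `e⁻¹`, according to the sign of `c z`, lowers the bound on `|c z|` by `m`.
Once `|c z| ≤ m`, the element is itself a generator. -/
theorem hasWordLength_of_mem (h : IsAxial H Z α P ht c w) {A : Set G} {m : ℕ}
    (hA : ∀ a ∈ Z, |c a| ≤ m → a ∈ A) {e : G} (he : e ∈ Z) (hem : c e = m) (k : ℕ) {z : G}
    (hz : z ∈ Z) (hk : |c z| ≤ m * (k + 1)) : HasWordLength A z (k + 1) := by
  induction k generalizing z with
  | zero => exact hasWordLength_one_of_mem (hA z hz (by simpa using hk))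
  | succ k ih =>
    have heA : HasWordLength A e 1 := hasWordLength_one_of_mem (hA e he (by rw [hem]; simp))
    have hm : (0 : ℤ) ≤ m * k := by positivity
    rw [abs_le] at hk
    push_cast at hk
    have hk1 : c z ≤ m * k + m + m := by linarith [hk.2]
    have hk2 : -(m * k + m + m) ≤ c z := by linarith [hk.1]
    rcases le_total 0 (c z) with h0 | h0
    · have h1 : HasWordLength A (e⁻¹ * z) (k + 1) := by
        refine ih (mul_mem (inv_mem he) hz) ?_
        rw [h.map_mul, h.map_inv, hem, abs_le]
        constructor <;> linarith
      have h2 := heA.mul h1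
      rw [mul_inv_cancel_left] at h2
      exact h2.mono (by omega)
    · have h1 : HasWordLength A (e * z) (k + 1) := by
        refine ih (mul_mem he hz) ?_
        rw [h.map_mul, hem, abs_le]
        constructor <;> linarith
      have h2 := heA.inv.mul h1
      rw [inv_mul_cancel_left] at h2
      exact h2.mono (by omega)

/-- This is the reverse inequality for the orbit map. If `P^[i] w = P^[j] (g w)` is the meet, `e ^
k` moves `w` just past it and `g z` reaches the same vertex from `g w`. Then `g = e ^ k * u⁻¹ * z⁻¹`
with `u` fixing `w`, and the three factors have lengths `k`, `2` and `j / m + 2`. -/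
theorem exists_hasWordLength (h : IsAxial H Z α P ht c w) (hHZ : H.IsComplement' Z) {A : Set G}
    {m : ℕ} (hm : 0 < m) (hA : ∀ a ∈ vertexStabilizer α H w, a ∈ A)
    (hA' : ∀ a ∈ Z, |c a| ≤ m → a ∈ A) {e : G} (he : e ∈ Z) (hem : c e = m) (g : G) :
    ∃ n : ℕ, HasWordLength A g n ∧ m * n ≤ Γ.dist w (α g w) + 5 * m := by
  obtain ⟨i, j, hij, hd⟩ := h.ancestral.exists_iterate_eq_dist w (α g w)
  have hcg := congrArg ht hij
  rw [h.ancestral.ht_iterate, h.ancestral.ht_iterate, h.ht_map] at hcg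
  have split : ∀ g : G, ∃ x ∈ H, ∃ z ∈ Z, x * z = g := by
    intro g
    obtain ⟨⟨x, z⟩, hxz⟩ := hHZ.2 g
    exact ⟨x, x.2, z, z.2, hxz⟩
  obtain ⟨x₀, hx₀, z₀, hz₀, hg⟩ := split g
  have hcz₀ : c z₀ = c g := by rw [← hg, h.map_mul, h.eq_zero _ hx₀, zero_add]
  -- Rounding up makes `m * k ≥ i`, so the climb passes the meet, by at most `m`.
  set k := i / m + 1 with hk
  have hi := Nat.div_add_mod i m
  have hi' := Nat.mod_lt i hm
  have hj := Nat.div_add_mod j m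
  have hj' := Nat.mod_lt j hm
  have hmk : m * k = m * (i / m) + m := by rw [hk, mul_add, mul_one]
  have hle : i ≤ m * k := by omega
  -- The factor `z₀⁻¹` cancels the height shift of `g`, so that `g z` and `e ^ k` move `w` to the
  -- same height. Since `c z ≥ 0`, the axis property applies to `z`.
  obtain ⟨z, hz⟩ : ∃ z, z = z₀⁻¹ * e ^ k := ⟨_, rfl⟩
  have hzZ : z ∈ Z := hz ▸ mul_mem (inv_mem hz₀) (pow_mem he k)
  have hce : c (e ^ k) = (m * k : ℕ) := by rw [h.map_pow, hem]; push_cast; ring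
  have hcz : c z = ((m * k - i + j : ℕ) : ℤ) := by
    rw [hz, h.map_mul, h.map_inv, hcz₀, hce]
    push_cast [hle]
    linarith
  have hfix : α (g * z) w = α (e ^ k) w := by
    rw [_root_.map_mul, RelIso.mul_apply, h.axis z hzZ _ hcz, h.map_iterate,
      Function.iterate_add_apply, ← hij, ← Function.iterate_add_apply, Nat.sub_add_cancel hle,
      h.axis _ (pow_mem he k) _ hce]
  obtain ⟨u, hu⟩ : ∃ u, u = (g * z)⁻¹ * e ^ k := ⟨_, rfl⟩
  have hufix : α u w = w := by
    rw [hu, _root_.map_mul, RelIso.mul_apply, ← hfix, inv_apply_apply]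
  have hcu : c u = 0 := by
    have h1 := h.ht_map u w
    rw [hufix] at h1
    omega
  obtain ⟨x, hx, y, hy, hxy⟩ := split u
  have hcy : c y = 0 := by
    rw [← hxy, h.map_mul, h.eq_zero _ hx, zero_add] at hcu
    exact hcu
  -- The axis property with `k = 0`: the part of `Z` of height zero fixes `w`, so the factor of `u`
  -- in `H` fixes `w` as well.
  have hyfix : α y w = w := h.axis y hy 0 (by simpa using hcy)
  have hxfix : α x w = w := by
    rw [← hxy, _root_.map_mul, RelIso.mul_apply, hyfix] at hufix
    exact hufix
  have l1 : HasWordLength A (e ^ k) k := by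
    refine h.hasWordLength_of_mem hA' he hem (i / m) (pow_mem he k) ?_
    rw [hce, Nat.abs_cast, hk]
    push_cast
    exact le_rfl
  have l2 : HasWordLength A u 2 := by
    rw [← hxy]
    exact (hasWordLength_one_of_mem (hA x ⟨hx, hxfix⟩)).mul
      (hasWordLength_one_of_mem (hA' y hy (by rw [hcy]; simp)))
  have l3 : HasWordLength A z (j / m + 2) := by
    refine h.hasWordLength_of_mem hA' he hem (j / m + 1) hzZ ?_
    rw [hcz, Nat.abs_cast]
    have h1 : m * k - i + j ≤ m * (j / m + 1 + 1) := by
      have h2 : m * (j / m + 1 + 1) = m * (j / m) + m + m := by ring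
      omega
    exact_mod_cast h1
  refine ⟨k + 2 + (j / m + 2), ?_, ?_⟩
  · have h1 := (l1.mul l2.inv).mul l3.inv
    have h2 : e ^ k * u⁻¹ * z⁻¹ = g := by rw [hu]; group
    rwa [h2] at h1
  · rw [← hd]
    have h1 : m * (k + 2 + (j / m + 2)) = m * (i / m) + m * (j / m) + 5 * m := by rw [hk]; ring
    omega

theorem cayley_preconnected (h : IsAxial H Z α P ht c w) (hHZ : H.IsComplement' Z) {A : Set G}
    {m : ℕ} (hm : 0 < m) (hA : ∀ a, a ∈ A ↔ a ∈ vertexStabilizer α H w ∨ a ∈ Z ∧ |c a| ≤ m)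
    {e : G} (he : e ∈ Z) (hem : c e = m) : (SimpleGraph.mulCayley A).Preconnected := by
  intro x y
  obtain ⟨n, hn, -⟩ := h.exists_hasWordLength hHZ hm (fun a ha => (hA a).2 (Or.inl ha))
    (fun a ha ha' => (hA a).2 (Or.inr ⟨ha, ha'⟩)) he hem (x⁻¹ * y)
  exact hn.reachable

theorem dist_le_mul_cayley_dist (h : IsAxial H Z α P ht c w) (hHZ : H.IsComplement' Z)
    {A : Set G} {m : ℕ} (hm : 0 < m)
    (hA : ∀ a, a ∈ A ↔ a ∈ vertexStabilizer α H w ∨ a ∈ Z ∧ |c a| ≤ m)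
    {e : G} (he : e ∈ Z) (hem : c e = m) (x y : G) :
    Γ.dist (α x w) (α y w) ≤ m * (SimpleGraph.mulCayley A).dist x y := by
  obtain ⟨p, hp⟩ := (h.cayley_preconnected hHZ hm hA he hem x y).exists_walk_length_eq_dist
  rw [← hp]
  exact h.dist_le_mul_length (fun a ha => (hA a).1 ha) p

theorem mul_cayley_dist_le (h : IsAxial H Z α P ht c w) (hHZ : H.IsComplement' Z)
    {A : Set G} {m : ℕ} (hm : 0 < m)
    (hA : ∀ a, a ∈ A ↔ a ∈ vertexStabilizer α H w ∨ a ∈ Z ∧ |c a| ≤ m)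
    {e : G} (he : e ∈ Z) (hem : c e = m) (x y : G) :
    m * (SimpleGraph.mulCayley A).dist x y ≤ Γ.dist (α x w) (α y w) + 5 * m := by
  obtain ⟨n, hn, hn'⟩ := h.exists_hasWordLength hHZ hm (fun a ha => (hA a).2 (Or.inl ha))
    (fun a ha ha' => (hA a).2 (Or.inr ⟨ha, ha'⟩)) he hem (x⁻¹ * y)
  have h1 : Γ.dist (α x w) (α y w) = Γ.dist w (α (x⁻¹ * y) w) := by
    rw [dist_apply_left, _root_.map_mul, RelIso.mul_apply]
  rw [h1]
  exact (Nat.mul_le_mul_left m hn.dist_le).trans hn'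

end IsAxial

/-- The same factor `m` occurs in both bounds, so Gromov products are scaled by `m` up to a bounded
error. The four-point condition therefore pulls back directly, without any stability of
quasi-geodesics. -/
theorem isHyperbolic_of_rough_isometry {V : Type v} {W : Type w} {Γ : SimpleGraph V}
    {Δ : SimpleGraph W} {f : V → W} {m : ℝ} (hm : 0 < m) {K : ℝ}
    (h1 : ∀ x y, (Δ.dist (f x) (f y) : ℝ) ≤ m * Γ.dist x y)
    (h2 : ∀ x y, m * Γ.dist x y ≤ Δ.dist (f x) (f y) + K) (h : IsHyperbolic Δ) :
    IsHyperbolic Γ := by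
  obtain ⟨δ, hδ⟩ := h
  refine ⟨(δ + 2 * K) / m, fun o x y z => ?_⟩
  have upper : ∀ a b, m * gromovProduct Γ o a b ≤ gromovProduct Δ (f o) (f a) (f b) + K := by
    intro a b
    simp only [gromovProduct]
    linarith [h2 o a, h2 o b, h1 a b]
  have lower : ∀ a b, gromovProduct Δ (f o) (f a) (f b) - K ≤ m * gromovProduct Γ o a b := by
    intro a b
    simp only [gromovProduct]
    linarith [h1 o a, h1 o b, h2 a b, (h1 o o).trans (h2 o o)]
  have h3 := hδ (f o) (f x) (f y) (f z)
  rw [sub_le_iff_le_add, min_le_iff] at h3 ⊢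
  have h4 : m * ((δ + 2 * K) / m) = δ + 2 * K := by field_simp
  rcases h3 with h3 | h3
  · left
    refine le_of_mul_le_mul_left ?_ hm
    rw [mul_add, h4]
    linarith [upper x y, lower x z]
  · right
    refine le_of_mul_le_mul_left ?_ hm
    rw [mul_add, h4]
    linarith [upper y z, lower x z]

namespace IsAxial

variable {G : Type u} [Group G] {H Z : Subgroup G} {V : Type v} {Γ : SimpleGraph V}
  {α : G →* (Γ ≃g Γ)} {P : V → V} {ht : V → ℤ} {c : G → ℤ} {w : V}

theorem exists_dist_orbit_le (h : IsAxial H Z α P ht c w) (hcob : IsCobounded α) (w' : V) :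
    ∃ R : ℕ, ∀ v : V, ∃ g : G, Γ.dist (α g w') v ≤ R := by
  obtain ⟨x, R, hR⟩ := hcob
  refine ⟨Γ.dist w' x + R, fun v => ?_⟩
  obtain ⟨g, hg⟩ := hR v
  refine ⟨g, ?_⟩
  have h1 := (h.ancestral.preconnected (α g w') (α g x)).dist_triangle_left v
  rw [dist_iso] at h1
  omega

/-- As `C` is a positive value of `ρ = r * c`, it equals `r * m` for a natural `m > 0`, and the slab
is `|c| ≤ m` on `Z`. The orbit map is then a rough similarity with coarsely dense image. -/
theorem isRepresentedBy (h : IsAxial H Z α P ht c w) (hHZ : H.IsComplement' Z)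
    {ρ : Z →* Multiplicative ℝ} {r : ℝ} (hr : 0 < r)
    (hρ : ∀ z : Z, (ρ z).toAdd = r * c z) (hcob : IsCobounded α) {C : ℝ}
    (hC : IsAdmissible ρ C) :
    IsRepresentedBy ((vertexStabilizer α H w : Set G) ∪ slab ρ C) α ∧
      IsEquivariantlyQuasiIsometric
        (cayleyAction ((vertexStabilizer α H w : Set G) ∪ slab ρ C)) α := by
  obtain ⟨hC0, -, e, he⟩ := hC
  have hce : 0 < c e := by
    rw [hρ] at he
    have h1 : (0 : ℝ) < c e := by
      by_contra hneg
      nlinarith [not_lt.1 hneg]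
    exact_mod_cast h1
  obtain ⟨m, hem⟩ := Int.eq_ofNat_of_zero_le hce.le
  have hm : 0 < m := by omega
  have hCm : C = r * m := by
    rw [← he, hρ, hem]
    simp
  obtain ⟨A, hAdef⟩ : ∃ A : Set G, A = (vertexStabilizer α H w : Set G) ∪ slab ρ C := ⟨_, rfl⟩
  have hA : ∀ a, a ∈ A ↔ a ∈ vertexStabilizer α H w ∨ a ∈ Z ∧ |c a| ≤ m := by
    have key : ∀ z : Z, |(ρ z).toAdd| ≤ C ↔ |c z| ≤ m := by
      intro z
      rw [hρ, abs_mul, abs_of_pos hr, hCm, mul_le_mul_iff_right₀ hr]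
      exact_mod_cast Iff.rfl
    intro a
    rw [hAdef]
    refine or_congr Iff.rfl ⟨?_, ?_⟩
    · rintro ⟨z, rfl, hz⟩
      exact ⟨z.2, (key z).1 hz⟩
    · rintro ⟨hz, hz'⟩
      exact ⟨⟨a, hz⟩, rfl, (key ⟨a, hz⟩).2 hz'⟩
  rw [← hAdef]
  have lower : ∀ x y, (Γ.dist (α x w) (α y w) : ℝ) ≤ m * (SimpleGraph.mulCayley A).dist x y :=
    fun x y => by exact_mod_cast h.dist_le_mul_cayley_dist hHZ hm hA e.2 hem x y
  have upper : ∀ x y, (m : ℝ) * (SimpleGraph.mulCayley A).dist x y ≤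
      Γ.dist (α x w) (α y w) + 5 * m :=
    fun x y => by exact_mod_cast h.mul_cayley_dist_le hHZ hm hA e.2 hem x y
  have upper' : ∀ x y, ((SimpleGraph.mulCayley A).dist x y : ℝ) ≤
      Γ.dist (α x w) (α y w) + 5 := by
    intro x y
    have h1 : m * (SimpleGraph.mulCayley A).dist x y ≤ m * (Γ.dist (α x w) (α y w) + 5) := by
      have h2 := h.mul_cayley_dist_le hHZ hm hA e.2 hem x y
      have h3 := Nat.le_mul_of_pos_left (Γ.dist (α x w) (α y w)) hm
      rw [mul_add]
      omega
    exact_mod_cast Nat.le_of_mul_le_mul_left h1 hm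
  have hmR : (1 : ℝ) ≤ m := by exact_mod_cast hm
  have hpre := h.cayley_preconnected hHZ hm hA e.2 hem
  have hconn := h.ancestral.preconnected
  obtain ⟨R, hR⟩ := h.exists_dist_orbit_le hcob w
  have hequiv : ∀ g x : G, α (cayleyAction A g x) w = α g (α x w) := by
    intro g x
    rw [cayleyAction_apply, _root_.map_mul, RelIso.mul_apply]
  refine ⟨⟨⟨closure_eq_top_of_preconnected hpre, ?_⟩, ?_, h.ancestral.isHyperbolic, hcob, ?_, ?_⟩,
    ?_⟩
  · exact isHyperbolic_of_rough_isometry (f := fun g => α g w) (by linarith) lower upper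
      h.ancestral.isHyperbolic
  · exact (SimpleGraph.connected_iff _).2 ⟨hconn, ⟨w⟩⟩
  -- The coarse inverse sends a vertex to some `g` with `g w` within `R`. The choice is not
  -- equivariant, but replacing it costs at most `2 * R` in the graph.
  · choose σ hσ using hR
    have hσ' : ∀ v, (Γ.dist (α (σ v) w) v : ℝ) ≤ R := fun v => by exact_mod_cast hσ v
    have tri : ∀ a b c : V, (Γ.dist a c : ℝ) ≤ Γ.dist a b + Γ.dist b c := fun a b c => by
      exact_mod_cast (hconn a b).dist_triangle_left c
    refine ⟨σ, ⟨2 * R + 5, fun x y => ?_⟩, fun x => ⟨2 * R + 5, fun g => ?_⟩⟩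
    · have h1 := upper' (σ x) (σ y)
      have h2 := tri (α (σ x) w) x (α (σ y) w)
      have h3 := tri x y (α (σ y) w)
      rw [Γ.dist_comm (u := y)] at h3
      have h4 : (0 : ℝ) ≤ (2 * R + 4) * Γ.dist x y := by positivity
      linarith [hσ' x, hσ' y]
    · have h1 := upper' (σ (α g x)) (cayleyAction A g (σ x))
      rw [hequiv] at h1
      have h2 := tri (α (σ (α g x)) w) (α g x) (α g (α (σ x) w))
      rw [dist_iso, Γ.dist_comm (u := x)] at h2
      linarith [hσ' x, hσ' (α g x)]
  · refine ⟨fun g => α g w, ⟨m, fun x y => ?_⟩, fun x => ⟨0, fun g => ?_⟩⟩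
    · linarith [lower x y]
    · simp only [hequiv, SimpleGraph.dist_self, Nat.cast_zero, le_refl]
  · refine ⟨fun g => α g w, hequiv, m + 5 + R, ?_, fun x y => ?_, fun x y => ?_, fun y => ?_⟩
    · have : (0 : ℝ) ≤ R := by positivity
      linarith
    · have h1 : (0 : ℝ) ≤ (5 + R) * (SimpleGraph.mulCayley A).dist x y := by positivity
      have h2 : (0 : ℝ) ≤ R := by positivity
      linarith [lower x y]
    · have h2 : (0 : ℝ) ≤ R := by positivity
      have h1 : ((SimpleGraph.mulCayley A).dist x y : ℝ) / (m + 5 + R) ≤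
          (SimpleGraph.mulCayley A).dist x y := div_le_self (by positivity) (by linarith)
      linarith [upper' x y]
    · obtain ⟨g, hg⟩ := hR y
      have h1 : (Γ.dist (α g w) y : ℝ) ≤ R := by exact_mod_cast hg
      exact ⟨g, by linarith⟩

end IsAxial

/-! ### Ascending HNN-extensions -/

section Ascending

variable {G : Type u} [Group G] {K : Subgroup G} {a : G}

/-- The subgroup `a⁻¹ K a` of `K`. -/
def conjSubgroup (K : Subgroup G) (a : G) : Subgroup K where
  carrier := {k | a * k * a⁻¹ ∈ K}
  one_mem' := by simp
  mul_mem' := by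
    intro x y hx hy
    have h1 : a * ((x * y : K) : G) * a⁻¹ = (a * x * a⁻¹) * (a * y * a⁻¹) := by
      rw [Subgroup.coe_mul]; group
    change a * ((x * y : K) : G) * a⁻¹ ∈ K
    rw [h1]
    exact mul_mem hx hy
  inv_mem' := by
    intro x hx
    have h1 : a * ((x⁻¹ : K) : G) * a⁻¹ = (a * x * a⁻¹)⁻¹ := by
      rw [Subgroup.coe_inv]; group
    change a * ((x⁻¹ : K) : G) * a⁻¹ ∈ K
    rw [h1]
    exact inv_mem hx

/-- Conjugation by `a`, as an isomorphism from `a⁻¹ K a` onto `K`. -/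
def conjEquiv (hK : ∀ k ∈ K, a⁻¹ * k * a ∈ K) : conjSubgroup K a ≃* (⊤ : Subgroup K) where
  toFun x := ⟨⟨a * x * a⁻¹, x.2⟩, Subgroup.mem_top _⟩
  invFun y := ⟨⟨a⁻¹ * y * a, hK _ (y : K).2⟩, by
    change a * (a⁻¹ * y * a) * a⁻¹ ∈ K
    have h1 : a * (a⁻¹ * (y : G) * a) * a⁻¹ = y := by group
    rw [h1]
    exact (y : K).2⟩
  left_inv x := by
    ext
    change a⁻¹ * (a * x * a⁻¹) * a = (x : G)
    group
  right_inv y := by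
    ext
    change a * (a⁻¹ * y * a) * a⁻¹ = (y : G)
    group
  map_mul' x y := by
    ext
    change a * (x * y) * a⁻¹ = (a * (x : G) * a⁻¹) * (a * y * a⁻¹)
    group

/-- Since the isomorphism is onto the whole base, every base element can be moved to the right past
`t`. Positive powers of `t` thus collect on the left and negative ones on the right. -/
theorem exists_normal_form (hK : ∀ k ∈ K, a⁻¹ * k * a ∈ K)
    (x : HNNExtension K (conjSubgroup K a) ⊤ (conjEquiv hK)) :
    ∃ (i : ℕ) (k : K) (j : ℕ),
      x = HNNExtension.t ^ i * HNNExtension.of k * (HNNExtension.t ^ j)⁻¹ := by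
  have comm1 : ∀ k : K, ∃ k' : K,
      (HNNExtension.of k : HNNExtension K (conjSubgroup K a) ⊤ (conjEquiv hK)) * HNNExtension.t =
        HNNExtension.t * HNNExtension.of k' := fun k =>
    ⟨_, HNNExtension.of_mul_t (φ := conjEquiv hK) ⟨k, Subgroup.mem_top _⟩⟩
  have comm : ∀ (n : ℕ) (k : K), ∃ k' : K,
      (HNNExtension.of k : HNNExtension K (conjSubgroup K a) ⊤ (conjEquiv hK)) *
        HNNExtension.t ^ n = HNNExtension.t ^ n * HNNExtension.of k' := by
    intro n
    induction n with
    | zero => exact fun k => ⟨k, by simp⟩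
    | succ n ih =>
      intro k
      obtain ⟨k₁, h₁⟩ := ih k
      obtain ⟨k₂, h₂⟩ := comm1 k₁
      exact ⟨k₂, by rw [pow_succ, ← mul_assoc, h₁, mul_assoc, h₂, mul_assoc]⟩
  induction x using HNNExtension.induction_on with
  | of g => exact ⟨0, g, 0, by simp⟩
  | t => exact ⟨1, 1, 0, by simp⟩
  | inv x ih =>
    obtain ⟨i, k, j, rfl⟩ := ih
    exact ⟨j, k⁻¹, i, by rw [map_inv]; group⟩
  | mul x y hx hy =>
    obtain ⟨i, k, j, rfl⟩ := hx
    obtain ⟨i', k', j', rfl⟩ := hy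
    -- In the middle, `t ^ (-j) * t ^ i'` leaves a power of one sign: a positive one moves left past
    -- `k`, a negative one right past `k'`.
    rcases le_total j i' with hj | hj
    · obtain ⟨s, rfl⟩ := Nat.exists_eq_add_of_le hj
      obtain ⟨l, hl⟩ := comm s k
      refine ⟨i + s, l * k', j', ?_⟩
      rw [map_mul, pow_add _ j, pow_add _ i]
      calc _ = HNNExtension.t ^ i * (HNNExtension.of k * HNNExtension.t ^ s) *
              HNNExtension.of k' * (HNNExtension.t ^ j')⁻¹ := by group
        _ = _ := by rw [hl]; group
    · obtain ⟨s, rfl⟩ := Nat.exists_eq_add_of_le hj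
      obtain ⟨l, hl⟩ := comm s k'⁻¹
      refine ⟨i, k * l⁻¹, j' + s, ?_⟩
      have hl' : ((HNNExtension.t ^ s)⁻¹ * HNNExtension.of k' :
            HNNExtension K (conjSubgroup K a) ⊤ (conjEquiv hK)) =
          HNNExtension.of l⁻¹ * (HNNExtension.t ^ s)⁻¹ := by
        have h1 := congrArg (fun y => y⁻¹) hl
        simpa only [mul_inv_rev, map_inv, inv_inv] using h1
      rw [map_mul, pow_add _ j', pow_add _ i']
      calc _ = HNNExtension.t ^ i * HNNExtension.of k *
              ((HNNExtension.t ^ s)⁻¹ * HNNExtension.of k') * (HNNExtension.t ^ j')⁻¹ := by group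
        _ = _ := by rw [hl']; group

variable {χ : G →* Multiplicative ℤ}

/-- The canonical map from the HNN-extension is onto by absorption. For the kernel, write an element
as `t ^ i * k * (t ^ j)⁻¹`: the height `χ` forces `i = j`, and then `k` is conjugate to the trivial
element. -/
theorem isAscendingHNN (hK : ∀ k ∈ K, a⁻¹ * k * a ∈ K)
    (habs : ∀ g : G, ∃ i j : ℕ, (a ^ i)⁻¹ * g * a ^ j ∈ K)
    (hχ : ∀ k ∈ K, χ k = 1) (hχa : χ a = Multiplicative.ofAdd 1) : IsAscendingHNN K a := by
  obtain ⟨F, hF⟩ : ∃ F, F = HNNExtension.lift (φ := conjEquiv hK) K.subtype a (fun x => by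
      change a * (x : G) = a * x * a⁻¹ * a
      group) := ⟨_, rfl⟩
  have hof : ∀ k : K, F (HNNExtension.of k) = k := fun k => by
    rw [hF, HNNExtension.lift_of]; rfl
  have ht : F HNNExtension.t = a := by rw [hF, HNNExtension.lift_t]
  have hbij : Function.Bijective F := by
    constructor
    · rw [injective_iff_map_eq_one]
      intro x hx
      obtain ⟨i, k, j, rfl⟩ := exists_normal_form hK x
      rw [map_mul, map_mul, map_inv, map_pow, map_pow, hof, ht] at hx
      have hij : i = j := by
        have h1 := congrArg (fun g => (χ g).toAdd) hx
        simp only [map_mul, map_inv, map_pow, hχ k k.2, hχa, map_one, toAdd_mul, toAdd_inv,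
          toAdd_pow, toAdd_one, toAdd_ofAdd] at h1
        simp only [mul_one, nsmul_eq_mul] at h1
        omega
      subst hij
      rw [mul_inv_eq_one, mul_eq_left] at hx
      have hk : k = 1 := Subtype.ext hx
      rw [hk, map_one, mul_one, mul_inv_cancel]
    · intro g
      obtain ⟨i, j, hg⟩ := habs g
      refine ⟨HNNExtension.t ^ i * HNNExtension.of ⟨_, hg⟩ * (HNNExtension.t ^ j)⁻¹, ?_⟩
      rw [map_mul, map_mul, map_inv, map_pow, map_pow, hof, ht]
      group
  exact ⟨conjSubgroup K a, conjEquiv hK, MulEquiv.ofBijective F hbij, hof, ht⟩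

/-- The parent of the vertex `gK` of the Bass–Serre tree is `gaK`. -/
def bassSerreParent (hK : ∀ k ∈ K, a⁻¹ * k * a ∈ K) : G ⧸ K → G ⧸ K :=
  Quotient.map' (fun g => g * a) (by
    intro x y hxy
    rw [QuotientGroup.leftRel_apply] at hxy ⊢
    have h1 : (x * a)⁻¹ * (y * a) = a⁻¹ * (x⁻¹ * y) * a := by group
    rw [h1]
    exact hK _ hxy)

theorem bassSerreParent_mk (hK : ∀ k ∈ K, a⁻¹ * k * a ∈ K) (g : G) :
    bassSerreParent hK (g : G ⧸ K) = ((g * a : G) : G ⧸ K) := rfl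

theorem bassSerreParent_iterate_mk (hK : ∀ k ∈ K, a⁻¹ * k * a ∈ K) (n : ℕ) (g : G) :
    (bassSerreParent hK)^[n] (g : G ⧸ K) = ((g * a ^ n : G) : G ⧸ K) := by
  induction n with
  | zero => simp
  | succ n ih => rw [Function.iterate_succ_apply', ih, bassSerreParent_mk, pow_succ, mul_assoc]

/-- The height on the Bass–Serre tree that is induced by `χ`. -/
def bassSerreHeight (hχ : ∀ k ∈ K, χ k = 1) : G ⧸ K → ℤ :=
  Quotient.lift (fun g => (χ g).toAdd) (by
    intro x y hxy
    have h1 := hχ _ (QuotientGroup.leftRel_apply.1 hxy)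
    rw [map_mul, map_inv, inv_mul_eq_one] at h1
    rw [h1])

theorem bassSerreHeight_mk (hχ : ∀ k ∈ K, χ k = 1) (g : G) :
    bassSerreHeight hχ (g : G ⧸ K) = (χ g).toAdd := rfl

/-- Absorption of `g⁻¹ * g'` says precisely that some iterated parents of `gK` and `g'K` coincide.
-/
theorem isAncestral_bassSerre (hK : ∀ k ∈ K, a⁻¹ * k * a ∈ K)
    (habs : ∀ g : G, ∃ i j : ℕ, (a ^ i)⁻¹ * g * a ^ j ∈ K)
    (hχ : ∀ k ∈ K, χ k = 1) (hχa : χ a = Multiplicative.ofAdd 1) :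
    IsAncestral (bassSerre K a) (bassSerreParent hK) (bassSerreHeight hχ) := by
  have hht : ∀ v, bassSerreHeight hχ (bassSerreParent hK v) = bassSerreHeight hχ v + 1 := by
    intro v
    induction v using QuotientGroup.induction_on with
    | H g =>
      rw [bassSerreParent_mk, bassSerreHeight_mk, bassSerreHeight_mk, map_mul, hχa, toAdd_mul,
        toAdd_ofAdd]
  have hrel : ∀ x y : G ⧸ K, (∃ g : G, x = (g : G ⧸ K) ∧ y = ((g * a : G) : G ⧸ K)) ↔
      bassSerreParent hK x = y := by
    intro x y
    constructor
    · rintro ⟨g, rfl, rfl⟩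
      rfl
    · rintro rfl
      induction x using QuotientGroup.induction_on with
      | H g => exact ⟨g, rfl, rfl⟩
  refine ⟨fun x y => ?_, hht, fun x y => ?_⟩
  · rw [bassSerre, SimpleGraph.fromRel_adj, hrel, hrel]
    -- `SimpleGraph.fromRel` discards loops. Nothing is lost, because the parent has greater height.
    refine ⟨fun h => h.2, fun h => ⟨?_, h⟩⟩
    rintro rfl
    rw [or_self] at h
    have h1 := hht x
    rw [h] at h1
    omega
  · induction x using QuotientGroup.induction_on with
    | H g =>
      induction y using QuotientGroup.induction_on with
      | H g' =>
        obtain ⟨i, j, hij⟩ := habs (g⁻¹ * g')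
        refine ⟨i, j, ?_⟩
        rw [bassSerreParent_iterate_mk, bassSerreParent_iterate_mk, QuotientGroup.eq]
        have h1 : (g * a ^ i)⁻¹ * (g' * a ^ j) = (a ^ i)⁻¹ * (g⁻¹ * g') * a ^ j := by group
        rwa [h1]

end Ascending

/-! ### Confining subgroups -/

section Confining

variable {G : Type u} [Group G] {H Z : Subgroup G} {ρ : Z →* Multiplicative ℝ}

theorem exists_isMinimalPositive (hρ : ρ ≠ 1) (hd : IsDiscrete ρ) :
    ∃ a : Z, IsMinimalPositive ρ a := by
  obtain ⟨⟨_, b, rfl⟩, hb⟩ := hd.exists_generator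
  have hz : ∀ z : Z, ∃ k : ℤ, (ρ z).toAdd = k * (ρ b).toAdd := by
    intro z
    obtain ⟨k, hk⟩ := Subgroup.mem_zpowers_iff.1 (hb ⟨ρ z, z, rfl⟩)
    refine ⟨k, ?_⟩
    have h1 := congrArg (fun x : ρ.range => Multiplicative.toAdd (x : Multiplicative ℝ)) hk
    simp only [Subgroup.coe_zpow, toAdd_zpow, zsmul_eq_mul] at h1
    exact h1.symm
  obtain ⟨a, s, ha, has⟩ : ∃ (a : Z) (s : ℤ), 0 < (ρ a).toAdd ∧
      (ρ b).toAdd = s * (ρ a).toAdd := by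
    rcases lt_trichotomy 0 (ρ b).toAdd with h | h | h
    · exact ⟨b, 1, h, by simp⟩
    · exfalso
      apply hρ
      ext z
      obtain ⟨k, hk⟩ := hz z
      rw [← h, mul_zero] at hk
      exact hk
    · refine ⟨b⁻¹, -1, ?_, ?_⟩
      · rw [map_inv, toAdd_inv]; linarith
      · rw [map_inv, toAdd_inv]; simp
  refine ⟨a, ha, fun z hpos => ?_⟩
  obtain ⟨k, hk⟩ := hz z
  rw [has, ← mul_assoc] at hk
  rw [hk] at hpos ⊢
  have h1 : (0 : ℝ) < ((k * s : ℤ) : ℝ) := by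
    push_cast
    exact (mul_pos_iff_of_pos_right ha).1 hpos
  have h2 : (1 : ℝ) ≤ ((k * s : ℤ) : ℝ) := by
    have h3 : 0 < k * s := by exact_mod_cast h1
    exact_mod_cast h3
  push_cast at h2
  nlinarith

/-- Euclidean division: the remainder lies in `[0, ρ a)` and is again a value of `ρ`, so by
minimality it is zero. -/
theorem IsMinimalPositive.exists_int {a : Z} (ha : IsMinimalPositive ρ a) (z : Z) :
    ∃ k : ℤ, (ρ z).toAdd = (ρ a).toAdd * k := by
  obtain ⟨hpos, hmin⟩ := ha
  refine ⟨⌊(ρ z).toAdd / (ρ a).toAdd⌋, ?_⟩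
  obtain ⟨k, hk⟩ : ∃ k, k = ⌊(ρ z).toAdd / (ρ a).toAdd⌋ := ⟨_, rfl⟩
  have h1 := Int.floor_le ((ρ z).toAdd / (ρ a).toAdd)
  have h2 := Int.lt_floor_add_one ((ρ z).toAdd / (ρ a).toAdd)
  rw [← hk] at h1 h2 ⊢
  rw [le_div_iff₀ hpos] at h1
  rw [div_lt_iff₀ hpos] at h2
  have h3 : (ρ (z * (a ^ k)⁻¹)).toAdd = (ρ z).toAdd - k * (ρ a).toAdd := by
    rw [map_mul, map_inv, map_zpow, toAdd_mul, toAdd_inv, toAdd_zpow, zsmul_eq_mul, sub_eq_add_neg]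
  by_contra hne
  have h4 := hmin (z * (a ^ k)⁻¹) (by
    rw [h3]
    rcases h1.lt_or_eq with h5 | h5
    · linarith
    · exact absurd (by rw [← h5, mul_comm]) hne)
  rw [h3] at h4
  linarith

theorem exists_mul_eq (hHZ : H.IsComplement' Z) (g : G) : ∃ x ∈ H, ∃ z : Z, x * z = g := by
  obtain ⟨⟨x, z⟩, hxz⟩ := hHZ.2 g
  exact ⟨x, x.2, z, hxz⟩

theorem right_eq_of_mul_eq (hHZ : H.IsComplement' Z) {x y : G} (hx : x ∈ H) (hy : y ∈ H)
    {z z' : Z} (h : x * z = y * z') : z = z' := by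
  have h1 : ((⟨x, hx⟩, z) : H × Z) = (⟨y, hy⟩, z') := hHZ.1 h
  exact congrArg Prod.snd h1

/-- A homomorphism on the complement `Z` of `H` extends to `G` trivially on `H`. -/
theorem exists_extension [H.Normal] (hHZ : H.IsComplement' Z) {M : Type v} [Group M]
    (φ : Z →* M) : ∃ χ : G →* M, (∀ h ∈ H, χ h = 1) ∧ ∀ z : Z, χ z = φ z := by
  choose x hx π hπ using exists_mul_eq hHZ
  have key : ∀ y ∈ H, ∀ z : Z, π (y * z) = z := fun y hy z =>
    right_eq_of_mul_eq hHZ (hx _) hy (hπ _)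
  have hmul : ∀ g g', π (g * g') = π g * π g' := by
    intro g g'
    have h1 : g * g' = (x g * (π g * x g' * (π g : G)⁻¹)) * ((π g * π g' : Z) : G) := by
      conv_lhs => rw [← hπ g, ← hπ g']
      rw [Subgroup.coe_mul]
      group
    rw [h1]
    exact key _ (mul_mem (hx g) (‹H.Normal›.conj_mem _ (hx g') _)) _
  refine ⟨MonoidHom.mk' (fun g => φ (π g)) (fun g g' => by rw [hmul, map_mul]), fun h hh => ?_,
    fun z => ?_⟩
  · have h1 := key h hh 1
    rw [Subgroup.coe_one, mul_one] at h1
    change φ (π h) = 1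
    rw [h1, map_one]
  · have h1 := key 1 (one_mem H) z
    rw [one_mul] at h1
    change φ (π z) = φ z
    rw [h1]

theorem IsMinimalPositive.exists_height [H.Normal] (hHZ : H.IsComplement' Z) {a : Z}
    (ha : IsMinimalPositive ρ a) : ∃ χ : G →* Multiplicative ℤ, (∀ h ∈ H, χ h = 1) ∧
      ∀ z : Z, (ρ z).toAdd = (ρ a).toAdd * ((χ z).toAdd : ℝ) := by
  choose k hk using ha.exists_int
  have hmul : ∀ z z', k (z * z') = k z + k z' := by
    intro z z'
    have h1 := hk (z * z')
    rw [map_mul, toAdd_mul, hk z, hk z', ← mul_add] at h1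
    have h2 := mul_left_cancel₀ ha.1.ne' h1
    exact_mod_cast h2.symm
  obtain ⟨χ, h1, h2⟩ := exists_extension hHZ
    (MonoidHom.mk' (fun z => Multiplicative.ofAdd (k z)) (fun z z' => by rw [hmul]; rfl))
  refine ⟨χ, h1, fun z => ?_⟩
  rw [h2]
  exact hk z

variable {Q : Subgroup G}

/-- Both `z` and `z⁻¹` have value zero, so `stays` applies in either direction and `ker ρ`
normalizes `Q`. This is why `Q ker ρ` is a subgroup. -/
theorem IsConfining.conj_mem_of_eq_one (hQ : IsConfining H Z ρ (Q : Set G)) {z : Z}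
    (hz : ρ z = 1) {q : G} (hq : q ∈ Q) : z * q * (z : G)⁻¹ ∈ Q := by
  have h1 := hQ.stays z⁻¹ (by rw [map_inv, hz]; simp) q hq
  rwa [Subgroup.coe_inv, inv_inv] at h1

/-- The subgroup `Q ker(ρ)`. -/
def IsConfining.base (hQ : IsConfining H Z ρ (Q : Set G)) : Subgroup G where
  carrier := {g | ∃ q ∈ Q, ∃ z : Z, ρ z = 1 ∧ q * z = g}
  one_mem' := ⟨1, one_mem _, 1, map_one _, by simp⟩
  mul_mem' := by
    rintro _ _ ⟨q, hq, z, hz, rfl⟩ ⟨q', hq', z', hz', rfl⟩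
    refine ⟨q * (z * q' * (z : G)⁻¹), mul_mem hq (hQ.conj_mem_of_eq_one hz hq'), z * z', ?_, ?_⟩
    · rw [map_mul, hz, hz', mul_one]
    · rw [Subgroup.coe_mul]; group
  inv_mem' := by
    rintro _ ⟨q, hq, z, hz, rfl⟩
    have hz' : ρ z⁻¹ = 1 := by rw [map_inv, hz, inv_one]
    refine ⟨_, hQ.conj_mem_of_eq_one hz' (inv_mem hq), z⁻¹, hz', ?_⟩
    rw [Subgroup.coe_inv]; group

theorem IsConfining.mem_base (hQ : IsConfining H Z ρ (Q : Set G)) {g : G} :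
    g ∈ hQ.base ↔ ∃ q ∈ Q, ∃ z : Z, ρ z = 1 ∧ q * z = g := Iff.rfl

theorem IsConfining.coe_base (hQ : IsConfining H Z ρ (Q : Set G)) :
    (hQ.base : Set G) = (Q : Set G) * (kerIn ρ : Set G) := by
  ext g
  rw [SetLike.mem_coe, hQ.mem_base, Set.mem_mul]
  constructor
  · rintro ⟨q, hq, z, hz, rfl⟩
    exact ⟨q, hq, z, ⟨z, hz, rfl⟩, rfl⟩
  · rintro ⟨q, hq, _, ⟨z, hz, rfl⟩, rfl⟩
    exact ⟨q, hq, z, hz, rfl⟩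

theorem IsConfining.mem_of_mem_base (hQ : IsConfining H Z ρ (Q : Set G))
    (hHZ : H.IsComplement' Z) {g : G} (hg : g ∈ hQ.base) (hgH : g ∈ H) : g ∈ Q := by
  obtain ⟨q, hq, z, hz, rfl⟩ := hg
  have h1 : (q * z) * ((1 : Z) : G) = q * z := by simp
  have h2 := right_eq_of_mul_eq hHZ hgH (hQ.subset hq) h1
  rw [← h2]
  simpa using hq

variable {a : Z}

theorem IsConfining.conj_mem_base (hQ : IsConfining H Z ρ (Q : Set G))
    (hcomm : ∀ z z' : Z, z * z' = z' * z) (ha : 0 < (ρ a).toAdd) :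
    ∀ k ∈ hQ.base, (a : G)⁻¹ * k * a ∈ hQ.base := by
  rintro _ ⟨q, hq, z, hz, rfl⟩
  refine ⟨_, hQ.stays a ha.le q hq, z, hz, ?_⟩
  have h1 : (z * a : G) = a * z := congrArg Subtype.val (hcomm z a)
  calc (a : G)⁻¹ * q * a * z = (a : G)⁻¹ * q * (a * z) := by group
    _ = _ := by rw [← h1]; group

theorem IsConfining.absorbing (hQ : IsConfining H Z ρ (Q : Set G)) (hHZ : H.IsComplement' Z)
    (ha : IsMinimalPositive ρ a) (g : G) :
    ∃ i j : ℕ, ((a : G) ^ i)⁻¹ * g * (a : G) ^ j ∈ hQ.base := by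
  obtain ⟨x, hx, z, rfl⟩ := exists_mul_eq hHZ g
  obtain ⟨y, hy⟩ := hQ.gets_in x hx
  obtain ⟨k, hk⟩ := ha.exists_int y
  obtain ⟨l, hl⟩ := ha.exists_int z
  -- The exponent must satisfy `i ≥ k`, so that conjugation by `y⁻¹ * a ^ i` keeps `Q`, and `i ≥ l`,
  -- so that `j = i - l` is natural. Then `a ^ (-i) * x * a ^ i ∈ Q` and `a ^ (-i) * z * a ^ j ∈ ker
  -- ρ`.
  obtain ⟨i, hi⟩ : ∃ i : ℕ, i = k.toNat + l.toNat := ⟨_, rfl⟩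
  obtain ⟨j, hj⟩ : ∃ j : ℕ, (j : ℤ) = i - l := ⟨(i - l).toNat, by omega⟩
  refine ⟨i, j, _, hQ.stays (y⁻¹ * a ^ i) ?_ _ hy, (a ^ i)⁻¹ * z * a ^ j, ?_, ?_⟩
  · rw [map_mul, map_inv, map_pow, toAdd_mul, toAdd_inv, toAdd_pow, hk, nsmul_eq_mul]
    have h1 : (k : ℝ) ≤ i := by
      have h2 : k ≤ i := by omega
      exact_mod_cast h2
    nlinarith [ha.1]
  · apply Multiplicative.toAdd.injective
    rw [map_mul ρ, map_mul ρ, map_inv, map_pow, map_pow, toAdd_mul, toAdd_mul, toAdd_inv, toAdd_pow,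
      toAdd_pow, hl, nsmul_eq_mul, nsmul_eq_mul, toAdd_one]
    have h1 : (j : ℝ) = i - l := by exact_mod_cast hj
    rw [h1]
    ring
  · push_cast
    group

/-- The base vertex is the coset `K`: an element `z` of height `k` satisfies `zK = a ^ k K` because
`(a ^ k)⁻¹ * z ∈ ker ρ`, and `K ∩ H = Q` by uniqueness of the decomposition. -/
theorem IsConfining.isAscendingHNN_isTree_isRepresentedBy [H.Normal]
    (hQ : IsConfining H Z ρ (Q : Set G)) (hHZ : H.IsComplement' Z)
    (hcomm : ∀ z z' : Z, z * z' = z' * z) (ha : IsMinimalPositive ρ a) :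
    IsAscendingHNN hQ.base (a : G) ∧ (bassSerre hQ.base (a : G)).IsTree ∧
      ∀ C : ℝ, IsAdmissible ρ C →
        IsRepresentedBy ((Q : Set G) ∪ slab ρ C) (bassSerreAction hQ.base (a : G)) := by
  obtain ⟨χ, hχH, hχZ⟩ := ha.exists_height hHZ
  have hK := hQ.conj_mem_base hcomm ha.1
  have habs := hQ.absorbing hHZ ha
  have hχker : ∀ z : Z, ρ z = 1 ↔ χ z = 1 := by
    intro z
    constructor
    · intro h1
      have h2 := hχZ z
      rw [h1, toAdd_one, eq_comm, mul_eq_zero, or_iff_right ha.1.ne'] at h2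
      exact Multiplicative.toAdd.injective (by exact_mod_cast h2)
    · intro h1
      have h2 := hχZ z
      rw [h1, toAdd_one, Int.cast_zero, mul_zero] at h2
      exact Multiplicative.toAdd.injective h2
  have hχK : ∀ k ∈ hQ.base, χ k = 1 := by
    rintro _ ⟨q, hq, z, hz, rfl⟩
    rw [map_mul, hχH q (hQ.subset hq), (hχker z).1 hz, mul_one]
  have hχa : χ a = Multiplicative.ofAdd 1 := by
    have h1 := hχZ a
    rw [eq_comm, mul_eq_left₀ ha.1.ne'] at h1
    exact Multiplicative.toAdd.injective (by exact_mod_cast h1)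
  have hanc := isAncestral_bassSerre hK habs hχK hχa
  have hax : IsAxial H Z (bassSerreAction hQ.base (a : G)) (bassSerreParent hK)
      (bassSerreHeight hχK) (fun g => (χ g).toAdd) ((1 : G) : G ⧸ hQ.base) := by
    refine ⟨hanc, fun g v => ?_, fun g v => ?_, fun h hh => ?_, fun z hz k hk => ?_⟩
    · induction v using QuotientGroup.induction_on with
      | H g' =>
        change ((g * (g' * a) : G) : G ⧸ hQ.base) = ((g * g' * a : G) : G ⧸ hQ.base)
        rw [mul_assoc]
    · induction v using QuotientGroup.induction_on with
      | H g' =>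
        change (χ (g * g')).toAdd = (χ g').toAdd + (χ g).toAdd
        rw [map_mul, toAdd_mul, add_comm]
    · rw [hχH h hh, toAdd_one]
    · rw [bassSerreParent_iterate_mk, one_mul]
      change ((z * 1 : G) : G ⧸ hQ.base) = _
      rw [mul_one, eq_comm, QuotientGroup.eq]
      refine ⟨1, one_mem _, (a ^ k)⁻¹ * ⟨z, hz⟩, ?_, by simp⟩
      rw [hχker]
      apply Multiplicative.toAdd.injective
      push_cast
      rw [map_mul, map_inv, map_pow, hχa, toAdd_mul, hk]
      simp
  have hstab : vertexStabilizer (bassSerreAction hQ.base (a : G)) H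
      ((1 : G) : G ⧸ hQ.base) = Q := by
    ext g
    change (g ∈ H ∧ ((g * 1 : G) : G ⧸ hQ.base) = ((1 : G) : G ⧸ hQ.base)) ↔ _
    rw [mul_one, eq_comm, QuotientGroup.eq, inv_one, one_mul]
    constructor
    · rintro ⟨h1, h2⟩
      exact hQ.mem_of_mem_base hHZ h2 h1
    · intro h1
      exact ⟨hQ.subset h1, g, h1, 1, map_one _, by simp⟩
  have hcob : IsCobounded (bassSerreAction hQ.base (a : G)) := by
    refine ⟨((1 : G) : G ⧸ hQ.base), 0, fun v => ?_⟩
    induction v using QuotientGroup.induction_on with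
    | H g =>
      refine ⟨g, ?_⟩
      change (bassSerre hQ.base (a : G)).dist ((g * 1 : G) : G ⧸ hQ.base) _ ≤ 0
      rw [mul_one, SimpleGraph.dist_self]
  have : Nonempty (G ⧸ hQ.base) := ⟨((1 : G) : G ⧸ hQ.base)⟩
  refine ⟨isAscendingHNN hK habs hχK hχa, hanc.isTree, fun C hC => ?_⟩
  have h1 := (hax.isRepresentedBy hHZ ha.1 hχZ hcob hC).1
  rwa [hstab] at h1

end Confining

/-! ### Ends of trees -/

section Tree

variable {V : Type v} {Γ : SimpleGraph V}

/-- `u` is a neighbour of `v` that is closer to `x`. -/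
def IsCloser (Γ : SimpleGraph V) (x v u : V) : Prop :=
  Γ.Adj v u ∧ Γ.dist u x + 1 = Γ.dist v x

theorem IsCloser.unique (hΓ : Γ.IsTree) {x v u u' : V} (h : IsCloser Γ x v u)
    (h' : IsCloser Γ x v u') : u = u' := by
  have key : ∀ {u : V}, IsCloser Γ x v u →
      ∃ p : Γ.Walk v x, p.IsPath ∧ p.snd = u := by
    intro u h
    obtain ⟨p, hp⟩ := hΓ.connected.exists_walk_length_eq_dist u x
    refine ⟨.cons h.1 p, SimpleGraph.Walk.isPath_of_length_eq_dist _ ?_, by simp⟩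
    rw [SimpleGraph.Walk.length_cons, hp, h.2]
  obtain ⟨p, hp, rfl⟩ := key h
  obtain ⟨q, hq, rfl⟩ := key h'
  rw [(hΓ.existsUnique_path v x).unique hp hq]

theorem exists_isCloser (hΓ : Γ.IsTree) {x v : V} (h : Γ.dist v x ≠ 0) :
    ∃ u, IsCloser Γ x v u := by
  obtain ⟨p, hp⟩ := hΓ.connected.exists_walk_length_eq_dist v x
  cases p with
  | nil => simp at h
  | cons hadj p =>
    rename_i u
    refine ⟨u, hadj, ?_⟩
    rw [SimpleGraph.Walk.length_cons] at hp
    have h1 := SimpleGraph.dist_le p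
    have h2 := hΓ.connected.dist_triangle (u := v) (v := u) (w := x)
    rw [SimpleGraph.dist_eq_one_iff_adj.2 hadj] at h2
    omega

theorem isCloser_symm_of_not (hΓ : Γ.IsTree) {x v u : V} (hadj : Γ.Adj v u)
    (h : ¬ IsCloser Γ x v u) : IsCloser Γ x u v := by
  refine ⟨hadj.symm, ?_⟩
  have h1 := hΓ.dist_eq_dist_add_one_of_adj x hadj
  rw [Γ.dist_comm (u := x), Γ.dist_comm (u := x)] at h1
  rcases h1 with h1 | h1
  · exact absurd ⟨hadj, h1.symm⟩ h
  · exact h1.symm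

/-- Local geodesics in a tree are geodesics. Push the edge one step towards `x`; by uniqueness of
the closer neighbour the new edge still points away from `y`. -/
theorem dist_eq_add_of_not_isCloser (hΓ : Γ.IsTree) {x y : V} (n : ℕ) {v u : V}
    (hd : Γ.dist u x = n) (hx : IsCloser Γ x v u) (hy : IsCloser Γ y u v) :
    Γ.dist x y = Γ.dist v x + Γ.dist v y := by
  induction n generalizing v u with
  | zero =>
    have h1 : u = x := (hΓ.connected.dist_eq_zero_iff).1 hd
    subst h1
    rw [← hy.2, ← hx.2, hd]
    omega
  | succ n ih =>
    obtain ⟨u', hu'⟩ := exists_isCloser hΓ (x := x) (v := u) (by omega)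
    have hne : u' ≠ v := by
      rintro rfl
      have h1 := hu'.2
      have h2 := hx.2
      omega
    have h1 := ih (by have := hu'.2; omega) hu'
      (isCloser_symm_of_not hΓ hu'.1 fun h => hne (h.unique hΓ hy))
    rw [h1, ← hx.2, ← hy.2]
    omega

/-- If the directions differ, `v` lies between `x` and `y` and the Gromov product at `v` is zero. -/
theorem IsCloser.eq_of_one_le_gromovProduct (hΓ : Γ.IsTree) {x y v u u' : V}
    (h : 1 ≤ gromovProduct Γ v x y) (hx : IsCloser Γ x v u) (hy : IsCloser Γ y v u') :
    u = u' := by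
  by_contra hne
  have h1 : IsCloser Γ y u v :=
    isCloser_symm_of_not hΓ hx.1 fun h2 => hne (h2.unique hΓ hy)
  have h2 := dist_eq_add_of_not_isCloser hΓ _ rfl hx h1
  rw [gromovProduct, h2] at h
  push_cast at h
  linarith

theorem IsCloser.map {x v u : V} (e : Γ ≃g Γ) (h : IsCloser Γ x v u) :
    IsCloser Γ (e x) (e v) (e u) := by
  refine ⟨e.map_adj_iff.2 h.1, ?_⟩
  rw [dist_iso, dist_iso]
  exact h.2

theorem gromovProduct_le_dist_left (hΓ : Γ.IsTree) (o x y : V) :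
    gromovProduct Γ o x y ≤ Γ.dist o x := by
  have h1 : (Γ.dist o y : ℝ) ≤ Γ.dist o x + Γ.dist x y := by
    exact_mod_cast hΓ.connected.dist_triangle
  rw [gromovProduct]
  linarith

theorem gromovProduct_comm (o x y : V) : gromovProduct Γ o x y = gromovProduct Γ o y x := by
  rw [gromovProduct, gromovProduct, Γ.dist_comm (u := x)]
  ring

theorem CoConverge.exists_isCloser (hΓ : Γ.IsTree) {x y : ℕ → V} (h : CoConverge Γ x y) (v : V) :
    ∃ u, (∀ᶠ n in atTop, IsCloser Γ (x n) v u) ∧ ∀ᶠ n in atTop, IsCloser Γ (y n) v u := by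
  obtain ⟨N, hN⟩ := eventually_atTop_prod_self.1 ((h v).eventually_ge_atTop 1)
  have hx : ∀ n ≥ N, ∃ u, IsCloser Γ (x n) v u := by
    intro n hn
    refine ConfTree.exists_isCloser hΓ fun h0 => ?_
    have h1 := (hN n N hn le_rfl).trans (gromovProduct_le_dist_left hΓ _ _ _)
    simp only [h0, Nat.cast_zero] at h1
    linarith
  have hy : ∀ n ≥ N, ∃ u, IsCloser Γ (y n) v u := by
    intro n hn
    refine ConfTree.exists_isCloser hΓ fun h0 => ?_
    have h1 := hN N n le_rfl hn
    rw [gromovProduct_comm] at h1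
    have h2 := h1.trans (gromovProduct_le_dist_left hΓ _ _ _)
    simp only [h0, Nat.cast_zero] at h2
    linarith
  obtain ⟨u, hu⟩ := hx N le_rfl
  obtain ⟨u', hu'⟩ := hy N le_rfl
  refine ⟨u, ?_, ?_⟩
  · filter_upwards [eventually_ge_atTop N] with n hn
    obtain ⟨t, ht⟩ := hx n hn
    have h1 := IsCloser.eq_of_one_le_gromovProduct hΓ (hN n N hn le_rfl) ht hu'
    have h2 := IsCloser.eq_of_one_le_gromovProduct hΓ (hN N N le_rfl le_rfl) hu hu'
    rwa [h2, ← h1]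
  · filter_upwards [eventually_ge_atTop N] with n hn
    obtain ⟨t, ht⟩ := hy n hn
    rwa [IsCloser.eq_of_one_le_gromovProduct hΓ (hN N n le_rfl hn) hu ht]

/-- The neighbour of `v` in the direction of the limit of the sequence `x`. -/
noncomputable def seqParent (Γ : SimpleGraph V) (x : ℕ → V) (v : V) : V :=
  @Classical.epsilon V ⟨v⟩ fun u => ∀ᶠ n in atTop, IsCloser Γ (x n) v u

theorem seqParent_spec (hΓ : Γ.IsTree) {x : ℕ → V} (h : CoConverge Γ x x) (v : V) :
    ∀ᶠ n in atTop, IsCloser Γ (x n) v (seqParent Γ x v) := by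
  obtain ⟨u, hu, -⟩ := h.exists_isCloser hΓ v
  exact Classical.epsilon_spec (p := fun u => ∀ᶠ n in atTop, IsCloser Γ (x n) v u) ⟨u, hu⟩

theorem seqParent_eq (hΓ : Γ.IsTree) {x : ℕ → V} (h : CoConverge Γ x x) {v u : V}
    (hu : ∀ᶠ n in atTop, IsCloser Γ (x n) v u) : seqParent Γ x v = u := by
  obtain ⟨n, h1, h2⟩ := ((seqParent_spec hΓ h v).and hu).exists
  exact h1.unique hΓ h2

/-- The parent function on a tree that points towards the end `ξ`. -/
noncomputable def Boundary.parent (hΓ : Γ.IsTree) (ξ : Boundary Γ) : V → V :=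
  Quot.lift (fun x : GromovSeq Γ => seqParent Γ x.1) (fun x y h => by
    funext v
    obtain ⟨u, hu, hu'⟩ := CoConverge.exists_isCloser hΓ h v
    rw [seqParent_eq hΓ x.2 hu, seqParent_eq hΓ y.2 hu']) ξ

theorem ConvergesTo.parent_eq (hΓ : Γ.IsTree) {x : ℕ → V} {ξ : Boundary Γ}
    (h : ConvergesTo x ξ) : ξ.parent hΓ = seqParent Γ x := by
  obtain ⟨hx, rfl⟩ := h
  rfl

theorem Boundary.parent_boundaryMap (hΓ : Γ.IsTree) (e : Γ ≃g Γ) (ξ : Boundary Γ) (v : V) :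
    (boundaryMap e ξ).parent hΓ (e v) = e (ξ.parent hΓ v) := by
  induction ξ using Quot.ind with
  | mk x =>
    change seqParent Γ (fun n => e (x.1 n)) (e v) = e (seqParent Γ x.1 v)
    refine seqParent_eq hΓ (x.2.map e) ?_
    filter_upwards [seqParent_spec hΓ x.2 v] with n hn
    exact hn.map e

theorem FixesPoint.apply_parent (hΓ : Γ.IsTree) {G : Type u} [Group G] {α : G →* (Γ ≃g Γ)}
    {ξ : Boundary Γ} (h : FixesPoint α ξ) (g : G) (v : V) :
    α g (ξ.parent hΓ v) = ξ.parent hΓ (α g v) := by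
  rw [← Boundary.parent_boundaryMap, h g]

/-- The height is the Busemann function normalized at `o`. Each edge changes the defining difference
by exactly one for all late terms, in the direction given by the parent, so the difference is
eventually constant and no limit has to be taken. -/
theorem ConvergesTo.exists_isAncestral (hΓ : Γ.IsTree) {xs : ℕ → V} {ξ : Boundary Γ}
    (h : ConvergesTo xs ξ) (o : V) : ∃ ht : V → ℤ, IsAncestral Γ (ξ.parent hΓ) ht ∧
      ∀ v, ∀ᶠ n in atTop, ht v = (Γ.dist o (xs n) : ℤ) - Γ.dist v (xs n) := by
  have hspec : ∀ v, ∀ᶠ n in atTop, IsCloser Γ (xs n) v (ξ.parent hΓ v) := by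
    intro v
    rw [h.parent_eq hΓ]
    exact seqParent_spec hΓ h.choose v
  have hadj : ∀ u v, Γ.Adj u v → ξ.parent hΓ u = v ∨ ξ.parent hΓ v = u := by
    intro u v huv
    by_contra! hne
    obtain ⟨n, h1, h2⟩ := ((hspec u).and (hspec v)).exists
    have h3 : ¬ IsCloser Γ (xs n) u v := fun h3 => hne.1 (h1.unique hΓ h3)
    exact hne.2 (h2.unique hΓ (isCloser_symm_of_not hΓ huv h3))
  have hex : ∀ v, ∃ k : ℤ, ∀ᶠ n in atTop, k = (Γ.dist o (xs n) : ℤ) - Γ.dist v (xs n) := by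
    intro v
    obtain ⟨p⟩ := hΓ.connected.preconnected v o
    induction p with
    | nil => exact ⟨0, Eventually.of_forall fun n => by simp⟩
    | cons huv p ih =>
      rename_i a b c
      obtain ⟨k, hk⟩ := ih
      rcases hadj _ _ huv with h1 | h1
      · refine ⟨k - 1, ?_⟩
        filter_upwards [hk, hspec a] with n hn hn'
        rw [h1] at hn'
        have := hn'.2
        omega
      · refine ⟨k + 1, ?_⟩
        filter_upwards [hk, hspec b] with n hn hn'
        rw [h1] at hn'
        have := hn'.2
        omega
  choose ht hht using hex
  refine ⟨ht, ⟨fun u v => ⟨hadj u v, ?_⟩, fun v => ?_, fun u v => ?_⟩, hht⟩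
  · rintro (h1 | h1)
    · obtain ⟨n, hn⟩ := (hspec u).exists
      rw [← h1]
      exact hn.1
    · obtain ⟨n, hn⟩ := (hspec v).exists
      rw [← h1]
      exact hn.1.symm
  · obtain ⟨n, ⟨hn1, hn2⟩, hn3⟩ := (((hht v).and (hht (ξ.parent hΓ v))).and (hspec v)).exists
    have := hn3.2
    omega
  · obtain ⟨p⟩ := hΓ.connected.preconnected u v
    induction p with
    | nil => exact ⟨0, 0, rfl⟩
    | cons huv p ih =>
      obtain ⟨i, j, hij⟩ := ih
      rcases hadj _ _ huv with h1 | h1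
      · exact ⟨i + 1, j, by rw [Function.iterate_succ_apply, h1, hij]⟩
      · refine ⟨i, j + 1, ?_⟩
        rw [← h1, ← Function.iterate_succ_apply, Function.iterate_succ_apply', hij,
          ← Function.iterate_succ_apply' (f := ξ.parent hΓ)]

end Tree

/-! ### Coconvergence of sequences -/

section CoConverge

variable {V : Type v} {Γ : SimpleGraph V}

theorem gromovProduct_le_add (hΓ : Γ.Connected) (o o' x x' y y' : V) :
    gromovProduct Γ o x y ≤
      gromovProduct Γ o' x' y' + (Γ.dist o o' + Γ.dist x x' + Γ.dist y y') := by
  have tri : ∀ a b c : V, (Γ.dist a c : ℝ) ≤ Γ.dist a b + Γ.dist b c := fun a b c => by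
    exact_mod_cast hΓ.dist_triangle
  have h1 := tri o o' x
  have h2 := tri o' x' x
  have h3 := tri o o' y
  have h4 := tri o' y' y
  have h5 := tri x' x y'
  have h6 := tri x y y'
  rw [Γ.dist_comm (u := x') (v := x)] at h2 h5
  rw [Γ.dist_comm (u := y') (v := y)] at h4
  simp only [gromovProduct]
  linarith

theorem tendsto_gromovProduct_of_dist_le (hΓ : Γ.Connected) {x y x' y' : ℕ → V} {o o' : V} {D : ℕ}
    (hx : ∀ n, Γ.dist (x n) (x' n) ≤ D) (hy : ∀ n, Γ.dist (y n) (y' n) ≤ D)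
    (h : Tendsto (fun p : ℕ × ℕ => gromovProduct Γ o (x p.1) (y p.2)) atTop atTop) :
    Tendsto (fun p : ℕ × ℕ => gromovProduct Γ o' (x' p.1) (y' p.2)) atTop atTop := by
  refine tendsto_atTop_mono (fun p => ?_)
    (tendsto_atTop_add_const_right _ (-(Γ.dist o o' + D + D : ℝ)) h)
  have h1 := gromovProduct_le_add hΓ o o' (x p.1) (x' p.1) (y p.2) (y' p.2)
  have h2 : (Γ.dist (x p.1) (x' p.1) : ℝ) ≤ D := by exact_mod_cast hx p.1
  have h3 : (Γ.dist (y p.2) (y' p.2) : ℝ) ≤ D := by exact_mod_cast hy p.2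
  linarith

end CoConverge

/-! ### Actions on trees that fix an end -/

section Busemann

variable {G : Type u} [Group G] {V : Type v} {Γ : SimpleGraph V} {α : G →* (Γ ≃g Γ)}
  {P : V → V} {ht : V → ℤ} {c : G → ℤ}

/-- The shift `ht (g v) - ht v` is constant along each ray of ancestors, and any two such rays
merge. -/
theorem IsAncestral.exists_ht_map (h : IsAncestral Γ P ht)
    (hP : ∀ g v, α g (P v) = P (α g v)) (o : V) (g : G) (v : V) :
    ht (α g v) = ht v + (ht (α g o) - ht o) := by
  have key : ∀ (k : ℕ) (v : V), ht (α g (P^[k] v)) - ht (P^[k] v) = ht (α g v) - ht v := by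
    intro k v
    rw [map_iterate_of_comm (hP g), h.ht_iterate, h.ht_iterate]
    ring
  obtain ⟨i, j, hij⟩ := h.common v o
  have h1 := key i v
  rw [hij, key j o] at h1
  omega

/-- The `limsup` is that of an eventually constant sequence, so the quasimorphism equals the
homomorphism `c`, which homogenization does not change. -/
theorem busemann_eq {xs : ℕ → V} {x : V}
    (hht : ∀ v, ∀ᶠ n in atTop, ht v = (Γ.dist x (xs n) : ℤ) - Γ.dist v (xs n))
    (hc : ∀ g v, ht (α g v) = ht v + c g) (g : G) : busemann α x xs g = c g := by
  have hx : ht x = 0 := by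
    obtain ⟨n, hn⟩ := (hht x).exists
    rw [hn, sub_self]
  have hq : ∀ g, busemannQuasimorphism α x xs g = c g := by
    intro g
    refine Tendsto.limsup_eq (tendsto_const_nhds.congr' ?_)
    filter_upwards [hht (α g x)] with n hn
    rw [hc, hx, zero_add] at hn
    exact_mod_cast congrArg (Int.cast (R := ℝ)) hn
  have hpow : ∀ n : ℕ, c (g ^ n) = n * c g := by
    intro n
    induction n with
    | zero =>
      have h1 := hc 1 x
      rw [map_one, RelIso.one_apply] at h1
      rw [pow_zero]
      push_cast
      omega
    | succ n ih =>
      have h1 := hc (g ^ n * g) x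
      rw [map_mul, RelIso.mul_apply, hc, hc, ih] at h1
      rw [pow_succ]
      push_cast
      linarith
  refine Tendsto.limUnder_eq (tendsto_const_nhds.congr' ?_)
  filter_upwards [eventually_gt_atTop 0] with n hn
  have h1 : (n : ℝ) ≠ 0 := by exact_mod_cast hn.ne'
  rw [hq, hpow]
  push_cast
  field_simp

/-- If `c` vanished, the orbit of `x` would stay at one height, while `P^[R + 1] x` lies more than
`R` above it. -/
theorem IsAncestral.exists_ne_zero (h : IsAncestral Γ P ht)
    (hc : ∀ g v, ht (α g v) = ht v + c g) (hcob : IsCobounded α) : ∃ g, c g ≠ 0 := by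
  by_contra! h0
  obtain ⟨x, R, hR⟩ := hcob
  obtain ⟨g, hg⟩ := hR (P^[R + 1] x)
  have h1 := h.abs_ht_sub_le_dist (α g x) (P^[R + 1] x)
  rw [hc, h0, h.ht_iterate, abs_le] at h1
  push_cast at h1
  omega

theorem IsAncestral.exists_isAxial (h : IsAncestral Γ P ht)
    (hP : ∀ g v, α g (P v) = P (α g v)) (hc : ∀ g v, ht (α g v) = ht v + c g)
    {H Z : Subgroup G} (hH : ∀ x ∈ H, c x = 0) (hcomm : ∀ z ∈ Z, ∀ z' ∈ Z, z * z' = z' * z)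
    {b : G} (hb : b ∈ Z) (hcb : 0 < c b) (x : V) : ∃ w, IsAxial H Z α P ht c w := by
  have hPk : ∀ (g : G) (k : ℕ) (v : V), α g (P^[k] v) = P^[k] (α g v) := fun g =>
    map_iterate_of_comm (hP g)
  obtain ⟨m, hm⟩ := Int.eq_ofNat_of_zero_le hcb.le
  obtain ⟨i, j, hij⟩ := h.common x (α b x)
  have hi : i = j + m := by
    have h1 := congrArg ht hij
    rw [h.ht_iterate, h.ht_iterate, hc] at h1
    omega
  -- From this vertex on, the rays from `x` and `b x` agree, so `b` acts on the ray as `P^[m]`.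
  obtain ⟨w, hw⟩ : ∃ w, w = P^[j] x := ⟨_, rfl⟩
  have hbw : α b w = P^[m] w := by
    rw [hw, hPk, ← hij, hi, add_comm, Function.iterate_add_apply]
  have hbk : ∀ k : ℕ, α (b ^ k) w = P^[m * k] w := by
    intro k
    induction k with
    | zero => simp
    | succ k ih =>
      rw [pow_succ, map_mul, RelIso.mul_apply, hbw, hPk, ih, ← Function.iterate_add_apply,
        mul_add, mul_one, add_comm]
  refine ⟨w, h, hP, hc, hH, fun z hz k hk => ?_⟩
  obtain ⟨i, j, hij⟩ := h.common (α z w) w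
  have hj : j = i + k := by
    have h1 := congrArg ht hij
    rw [h.ht_iterate, h.ht_iterate, hc] at h1
    omega
  obtain ⟨s, hs⟩ : ∃ s, m * i = s + i :=
    ⟨m * i - i, (Nat.sub_add_cancel (Nat.le_mul_of_pos_left i (by omega))).symm⟩
  -- The vertices `z w` and `P^[k] w` are only known to have a common ancestor. Because `z` commutes
  -- with `b`, applying `b ^ i` to both replaces them by their ancestors `m * i ≥ i` steps up, which
  -- coincide.
  apply (α (b ^ i)).injective
  calc α (b ^ i) (α z w) = α z (α (b ^ i) w) := by
        rw [← RelIso.mul_apply, ← map_mul, hcomm _ (pow_mem hb i) z hz, map_mul, RelIso.mul_apply]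
    _ = P^[s] (P^[i] (α z w)) := by rw [hbk, hPk, hs, Function.iterate_add_apply]
    _ = P^[k] (P^[m * i] w) := by
        have e : s + j = k + m * i := by omega
        rw [hij, ← Function.iterate_add_apply, ← Function.iterate_add_apply, e]
    _ = α (b ^ i) (P^[k] w) := by rw [hPk, hbk]

end Busemann

/-! ### Confining stabilizers and the limit set of an axial action -/

namespace IsAxial

variable {G : Type u} [Group G] {H Z : Subgroup G} {V : Type v} {Γ : SimpleGraph V}
  {α : G →* (Γ ≃g Γ)} {P : V → V} {ht : V → ℤ} {c : G → ℤ} {w : V}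

theorem connected (h : IsAxial H Z α P ht c w) : Γ.Connected :=
  (SimpleGraph.connected_iff _).2 ⟨h.ancestral.preconnected, ⟨w⟩⟩

theorem exists_iterate_eq (h : IsAxial H Z α P ht c w) {x : G} (hx : x ∈ H) :
    ∃ i : ℕ, P^[i] (α x w) = P^[i] w := by
  obtain ⟨i, j, hij⟩ := h.ancestral.common (α x w) w
  have h1 := congrArg ht hij
  rw [h.ancestral.ht_iterate, h.ancestral.ht_iterate, h.ht_map, h.eq_zero x hx] at h1
  obtain rfl : i = j := by omega
  exact ⟨i, hij⟩

theorem conj_mem_vertexStabilizer [H.Normal] (h : IsAxial H Z α P ht c w) {z : G} (hz : z ∈ Z)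
    (hcz : 0 ≤ c z) {q : G} (hq : q ∈ vertexStabilizer α H w) :
    z⁻¹ * q * z ∈ vertexStabilizer α H w := by
  refine ⟨?_, ?_⟩
  · have h1 := ‹H.Normal›.conj_mem q hq.1 z⁻¹
    rwa [inv_inv] at h1
  · obtain ⟨k, hk⟩ := Int.eq_ofNat_of_zero_le hcz
    rw [_root_.map_mul, _root_.map_mul, RelIso.mul_apply, RelIso.mul_apply, h.axis z hz k hk,
      h.map_iterate, hq.2, ← h.axis z hz k hk, inv_apply_apply]

/-- An element of `H` has height shift zero, so it fixes a high enough ancestor of `w` and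
everything above; `b ^ i` moves `w` up there. -/
theorem exists_conj_pow_mem [H.Normal] (h : IsAxial H Z α P ht c w) {b : G} (hb : b ∈ Z)
    (hcb : 0 < c b) {x : G} (hx : x ∈ H) :
    ∃ i : ℕ, (b ^ i)⁻¹ * x * b ^ i ∈ vertexStabilizer α H w := by
  obtain ⟨m, hm⟩ := Int.eq_ofNat_of_zero_le hcb.le
  obtain ⟨i, hi⟩ := h.exists_iterate_eq hx
  obtain ⟨s, hs⟩ : ∃ s, i * m = s + i :=
    ⟨i * m - i, (Nat.sub_add_cancel (Nat.le_mul_of_pos_right i (by omega))).symm⟩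
  have hbi : α (b ^ i) w = P^[s + i] w := by
    refine h.axis _ (pow_mem hb i) _ ?_
    rw [h.map_pow, hm, ← hs]
    push_cast
    ring
  refine ⟨i, ?_, ?_⟩
  · have h1 := ‹H.Normal›.conj_mem x hx (b ^ i)⁻¹
    rwa [inv_inv] at h1
  · rw [_root_.map_mul, _root_.map_mul, RelIso.mul_apply, RelIso.mul_apply, hbi, h.map_iterate,
      Function.iterate_add_apply, hi, ← Function.iterate_add_apply, ← hbi, inv_apply_apply]

theorem isConfining [H.Normal] (h : IsAxial H Z α P ht c w) {ρ : Z →* Multiplicative ℝ}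
    (hρ : ∀ z : Z, (ρ z).toAdd = c z) {b : G} (hb : b ∈ Z) (hcb : 0 < c b) :
    IsConfining H Z ρ (vertexStabilizer α H w : Set G) where
  subset := fun q hq => hq.1
  symmetric := fun q hq => inv_mem (S := Subgroup G) hq
  stays := fun z hz q hq => h.conj_mem_vertexStabilizer z.2
    (by rw [hρ] at hz; exact_mod_cast hz) hq
  gets_in := fun x hx => by
    obtain ⟨i, hi⟩ := h.exists_conj_pow_mem hb hcb hx
    exact ⟨⟨b ^ i, pow_mem hb i⟩, hi⟩
  products := ⟨1, fun q hq r hr => by simpa using mul_mem (S := Subgroup G) hq hr⟩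

theorem dist_axis_axis (h : IsAxial H Z α P ht c w) {z z' : G} (hz : z ∈ Z) (hz' : z' ∈ Z) :
    (Γ.dist (α z w) (α z' w) : ℤ) = |c z - c z'| := by
  rw [dist_apply_left, ← RelIso.mul_apply, ← _root_.map_mul,
    h.dist_axis (mul_mem (inv_mem hz) hz'), h.map_mul, h.map_inv, ← abs_neg]
  congr 1
  ring

theorem gromovProduct_axis (h : IsAxial H Z α P ht c w) {z z' : G} (hz : z ∈ Z) (hz' : z' ∈ Z) :
    gromovProduct Γ w (α z w) (α z' w) = ((|c z| + |c z'| - |c z - c z'| : ℤ) : ℝ) / 2 := by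
  rw [← h.dist_axis_axis hz hz', ← h.dist_axis hz, ← h.dist_axis hz', gromovProduct]
  push_cast
  ring

/-- On the axis, distances are those of the integers `c z`, so the Gromov product of two points on
the same side of `w` is the smaller of their distances to `w`. -/
theorem tendsto_gromovProduct_axis (h : IsAxial H Z α P ht c w) {z z' : ℕ → G}
    (hz : ∀ n, z n ∈ Z) (hz' : ∀ n, z' n ∈ Z) {N : ℕ}
    (hpos : ∀ i ≥ N, ∀ j ≥ N, 0 < c (z i) * c (z' j))
    (ht1 : Tendsto (fun n => |c (z n)|) atTop atTop)
    (ht2 : Tendsto (fun n => |c (z' n)|) atTop atTop) :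
    Tendsto (fun p : ℕ × ℕ => gromovProduct Γ w (α (z p.1) w) (α (z' p.2) w)) atTop atTop := by
  rw [tendsto_atTop]
  intro B
  obtain ⟨N₁, h1⟩ := eventually_atTop.1 (ht1.eventually_ge_atTop ⌈B⌉)
  obtain ⟨N₂, h2⟩ := eventually_atTop.1 (ht2.eventually_ge_atTop ⌈B⌉)
  refine eventually_atTop_prod_self.2 ⟨max N (max N₁ N₂), fun i j hi hj => ?_⟩
  have e1 := h1 i (by omega)
  have e2 := h2 j (by omega)
  have e3 := hpos i (by omega) j (by omega)
  dsimp only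
  rw [h.gromovProduct_axis (hz i) (hz' j)]
  have e4 : 2 * ⌈B⌉ ≤ |c (z i)| + |c (z' j)| - |c (z i) - c (z' j)| := by
    rcases mul_pos_iff.1 e3 with ⟨p1, p2⟩ | ⟨p1, p2⟩
    · rw [abs_of_pos p1] at e1 ⊢
      rw [abs_of_pos p2] at e2 ⊢
      rcases abs_cases (c (z i) - c (z' j)) with h | h <;> omega
    · rw [abs_of_neg p1] at e1 ⊢
      rw [abs_of_neg p2] at e2 ⊢
      rcases abs_cases (c (z i) - c (z' j)) with h | h <;> omega
  have e5 : ((2 * ⌈B⌉ : ℤ) : ℝ) ≤ ((|c (z i)| + |c (z' j)| - |c (z i) - c (z' j)| : ℤ) : ℝ) := by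
    exact_mod_cast e4
  have e6 := Int.le_ceil B
  push_cast at e5 ⊢
  linarith

theorem tendsto_abs_pow (h : IsAxial H Z α P ht c w) {t : G} (hct : c t ≠ 0) :
    Tendsto (fun n : ℕ => |c (t ^ n)|) atTop atTop := by
  refine tendsto_atTop_mono (fun n => ?_) tendsto_natCast_atTop_atTop
  rw [h.map_pow, abs_mul, Nat.abs_cast]
  have h1 : 1 ≤ |c t| := Int.one_le_abs hct
  exact le_mul_of_one_le_right (by positivity) h1

theorem coConverge_pow (h : IsAxial H Z α P ht c w) {t : G} (ht : t ∈ Z) (hct : c t ≠ 0) :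
    CoConverge Γ (fun n => α (t ^ n) w) (fun n => α (t ^ n) w) := by
  have h0 : ∀ i ≥ 1, ∀ j ≥ 1, 0 < c (t ^ i) * c (t ^ j) := by
    intro i hi j hj
    have h1 : (0 : ℤ) < i := by omega
    have h2 : (0 : ℤ) < j := by omega
    have h3 : 0 < c t * c t := mul_self_pos.2 hct
    rw [h.map_pow, h.map_pow]
    calc (0 : ℤ) < i * j * (c t * c t) := by positivity
      _ = _ := by ring
  have h1 := h.tendsto_gromovProduct_axis (z := fun n => t ^ n) (z' := fun n => t ^ n) (N := 1)
    (fun n => pow_mem ht n) (fun n => pow_mem ht n) h0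
    (h.tendsto_abs_pow hct) (h.tendsto_abs_pow hct)
  intro o
  exact tendsto_gromovProduct_of_dist_le (x := fun n => α (t ^ n) w) (y := fun n => α (t ^ n) w)
    (x' := fun n => α (t ^ n) w) (y' := fun n => α (t ^ n) w) h.connected (D := 0)
    (fun n => by rw [SimpleGraph.dist_self]) (fun n => by rw [SimpleGraph.dist_self]) h1

/-- The boundary point to which the powers of `t` converge. -/
def powLimit (h : IsAxial H Z α P ht c w) {t : G} (ht : t ∈ Z) (hct : c t ≠ 0) : Boundary Γ :=
  Quot.mk _ ⟨fun n => α (t ^ n) w, h.coConverge_pow ht hct⟩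

/-- The parent map `N` towards the lower end of the axis also commutes with `G`, and it undoes `P`
along the axis. An element `x ∈ H` fixes some `P^[i] w`; applying `N^[i]` shows that it fixes `w`.
-/
theorem vertexStabilizer_eq_of_fixesPoint (h : IsAxial H Z α P ht c w) (hΓ : Γ.IsTree) {b : G}
    (hb : b⁻¹ ∈ Z) (hcb : c b⁻¹ ≠ 0) (hcb' : 0 < c b) (hfix : FixesPoint α (h.powLimit hb hcb)) :
    vertexStabilizer α H w = H := by
  obtain ⟨m, hm⟩ := Int.eq_ofNat_of_zero_le hcb'.le
  have hbZ : b ∈ Z := by simpa using hb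
  obtain ⟨N, hN⟩ : ∃ N, N = (h.powLimit hb hcb).parent hΓ := ⟨_, rfl⟩
  have hstep : ∀ i : ℕ, N (P^[i + 1] w) = P^[i] w := by
    intro i
    rw [hN]
    refine seqParent_eq hΓ (h.coConverge_pow hb hcb) (Eventually.of_forall fun n => ?_)
    have h1 : P^[m * n] (α (b⁻¹ ^ n) w) = w := by
      rw [← h.map_iterate, ← h.axis (b ^ n) (pow_mem hbZ n) (m * n), inv_pow, inv_apply_apply]
      rw [h.map_pow, hm]
      push_cast
      ring
    have h2 : ∀ k : ℕ, Γ.dist (P^[k] w) (α (b⁻¹ ^ n) w) = k + m * n := by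
      intro k
      conv_lhs => rw [← h1, ← Function.iterate_add_apply, Γ.dist_comm, h1]
      exact h.ancestral.dist_iterate _ _
    refine ⟨?_, ?_⟩
    · rw [Function.iterate_succ_apply']
      exact (h.ancestral.adj_parent _).symm
    · rw [h2, h2]
      ring
  have hback : ∀ i : ℕ, N^[i] (P^[i] w) = w := by
    intro i
    induction i with
    | zero => rfl
    | succ i ih => rw [Function.iterate_succ_apply, hstep, ih]
  ext x
  refine ⟨fun hx => hx.1, fun hx => ⟨hx, ?_⟩⟩
  obtain ⟨i, hi⟩ := h.exists_iterate_eq hx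
  have hNx : ∀ v, α x (N v) = N (α x v) := by
    rw [hN]
    exact hfix.apply_parent hΓ x
  calc α x w = α x (N^[i] (P^[i] w)) := by rw [hback]
    _ = N^[i] (P^[i] (α x w)) := by rw [map_iterate_of_comm hNx, h.map_iterate]
    _ = w := by rw [hi, hback]

theorem vertexStabilizer_eq_of_isOrientedLineal (h : IsAxial H Z α P ht c w) (hΓ : Γ.IsTree)
    {b : G} (hb : b ∈ Z) (hcb : 0 < c b) (hα : IsOrientedLineal α) :
    vertexStabilizer α H w = H := by
  have hcb' : c b⁻¹ ≠ 0 := by rw [h.map_inv]; omega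
  exact h.vertexStabilizer_eq_of_fixesPoint hΓ (inv_mem hb) hcb' hcb
    (hα.2 _ ⟨w, fun n => b⁻¹ ^ n, h.coConverge_pow (inv_mem hb) hcb', rfl⟩)

/-- If `H` fixes `w`, the orbit of `w` is the orbit under `Z` and lies on a line. Every orbit stays
within bounded distance of it, so only the two ends of the axis can be limits. -/
theorem limitSet_finite [H.Normal] (h : IsAxial H Z α P ht c w) (hHZ : H.IsComplement' Z)
    {b : G} (hb : b ∈ Z) (hcb : 0 < c b) (hstab : ∀ x ∈ H, α x w = w) : (limitSet α).Finite := by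
  have hcb' : c b⁻¹ < 0 := by rw [h.map_inv]; omega
  refine Set.Finite.subset
    (Set.toFinite {h.powLimit hb hcb.ne', h.powLimit (inv_mem hb) hcb'.ne}) ?_
  rintro ζ ⟨x, g, hconv, rfl⟩
  have hg : ∀ n, ∃ z ∈ Z, α (g n) w = α z w := by
    intro n
    obtain ⟨y, hy, z, hyz⟩ := exists_mul_eq hHZ (g n)
    refine ⟨z, z.2, ?_⟩
    have h1 := ‹H.Normal›.conj_mem y hy (z : G)⁻¹
    rw [inv_inv] at h1
    have h2 : g n = z * ((z : G)⁻¹ * y * z) := by rw [← hyz]; group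
    rw [h2, _root_.map_mul, RelIso.mul_apply, hstab _ h1]
  choose z hz hgz using hg
  have hdist : ∀ n, Γ.dist (α (g n) x) (α (z n) w) ≤ Γ.dist x w := by
    intro n
    rw [← hgz, dist_iso]
  have hself : Tendsto (fun p : ℕ × ℕ => gromovProduct Γ w (α (z p.1) w) (α (z p.2) w))
      atTop atTop :=
    tendsto_gromovProduct_of_dist_le (x := fun n => α (g n) x) (y := fun n => α (g n) x)
      (x' := fun n => α (z n) w) (y' := fun n => α (z n) w) h.connected hdist hdist (hconv w)
  obtain ⟨N, hN⟩ := eventually_atTop_prod_self.1 (hself.eventually_ge_atTop 1)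
  -- Points on opposite sides of `w` have Gromov product zero, so this bound makes all late `c (z
  -- i)` share the sign of `c (z N)`, which selects the end.
  have hN' : ∀ i ≥ N, ∀ j ≥ N, 2 ≤ |c (z i)| + |c (z j)| - |c (z i) - c (z j)| := by
    intro i hi j hj
    have h1 := hN i j hi hj
    rw [h.gromovProduct_axis (hz i) (hz j), le_div_iff₀ two_pos, one_mul] at h1
    exact_mod_cast h1
  have habs : Tendsto (fun n => |c (z n)|) atTop atTop := by
    have h1 := hself.comp tendsto_atTop_diagonal
    rw [← tendsto_intCast_atTop_iff (R := ℝ)]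
    refine h1.congr fun n => ?_
    change gromovProduct Γ w (α (z n) w) (α (z n) w) = _
    rw [h.gromovProduct_axis (hz n) (hz n), sub_self, abs_zero]
    push_cast
    ring
  have key : ∀ {t : G} (ht : t ∈ Z) (hct : c t ≠ 0), 0 < c (z N) * c t →
      (Quot.mk _ ⟨fun n => α (g n) x, hconv⟩ : Boundary Γ) = h.powLimit ht hct := by
    intro t ht hct hpos
    refine Quot.sound fun o => ?_
    have h1 : ∀ i ≥ N + 1, ∀ j ≥ N + 1, 0 < c (z i) * c (t ^ j) := by
      intro i hi j hj
      have h2 := hN' i (by omega) N le_rfl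
      have h3 : (0 : ℤ) < j := by omega
      have h4 : 0 < c (z i) * c t := by
        rcases mul_pos_iff.1 hpos with ⟨p1, p2⟩ | ⟨p1, p2⟩
        · refine mul_pos ?_ p2
          by_contra hneg
          rw [abs_of_nonpos (not_lt.1 hneg), abs_of_pos p1, abs_of_neg (by omega)] at h2
          omega
        · refine mul_pos_of_neg_of_neg ?_ p2
          by_contra hneg
          rw [abs_of_nonneg (not_lt.1 hneg), abs_of_neg p1, abs_of_pos (by omega)] at h2
          omega
      rw [h.map_pow, mul_left_comm]
      exact mul_pos h3 h4
    have h2 := h.tendsto_gromovProduct_axis hz (fun n => pow_mem ht n) h1 habs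
      (h.tendsto_abs_pow hct)
    refine tendsto_gromovProduct_of_dist_le (x := fun n => α (z n) w) (y := fun n => α (t ^ n) w)
      (x' := fun n => α (g n) x) (y' := fun n => α (t ^ n) w) h.connected (D := Γ.dist x w)
      (fun n => ?_) (fun n => ?_) h2
    · rw [Γ.dist_comm]
      exact hdist n
    · rw [SimpleGraph.dist_self]
      exact Nat.zero_le _
  have h0 : c (z N) ≠ 0 := by
    have h1 := hN' N le_rfl N le_rfl
    rw [sub_self, abs_zero] at h1
    intro h2
    rw [h2, abs_zero] at h1
    omega
  rcases lt_or_gt_of_ne h0 with h1 | h1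
  · exact Or.inr (key (inv_mem hb) hcb'.ne (mul_pos_of_neg_of_neg h1 hcb'))
  · exact Or.inl (key hb hcb.ne' (mul_pos h1 hcb))

theorem isStrictlyConfining [H.Normal] (h : IsAxial H Z α P ht c w) (hHZ : H.IsComplement' Z)
    {ρ : Z →* Multiplicative ℝ} (hρ : ∀ z : Z, (ρ z).toAdd = c z) {b : G} (hb : b ∈ Z)
    (hcb : 0 < c b) (hα : IsQuasiParabolic α) :
    IsStrictlyConfining H Z ρ (vertexStabilizer α H w : Set G) := by
  refine ⟨h.isConfining hρ hb hcb, ⟨b, hb⟩, ?_, fun hsub => ?_⟩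
  · rintro _ ⟨q, hq, rfl⟩
    exact h.conj_mem_vertexStabilizer hb hcb.le hq
  -- If the inclusion were an equality, `Q` would be stable under conjugation by `b` in both
  -- directions. As every element of `H` is conjugated into `Q` by a power of `b`, all of `H` would
  -- fix `w`.
  · have hconj : ∀ (i : ℕ), ∀ q ∈ vertexStabilizer α H w,
        b ^ i * q * (b ^ i)⁻¹ ∈ vertexStabilizer α H w := by
      intro i
      induction i with
      | zero => exact fun q hq => by simpa using hq
      | succ i ih =>
        intro q hq
        obtain ⟨r, hr, hrq⟩ := hsub hq
        have h1 : b ^ (i + 1) * q * (b ^ (i + 1))⁻¹ = b ^ i * r * (b ^ i)⁻¹ := by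
          rw [← hrq, pow_succ]
          group
        rw [h1]
        exact ih r hr
    refine hα.1 (h.limitSet_finite hHZ hb hcb fun x hx => ?_)
    obtain ⟨i, hi⟩ := h.exists_conj_pow_mem hb hcb hx
    have h1 := hconj i _ hi
    have h2 : b ^ i * ((b ^ i)⁻¹ * x * b ^ i) * (b ^ i)⁻¹ = x := by group
    rw [h2] at h1
    exact h1.2

end IsAxial

/-! ### Assembly of the two halves -/

theorem isDiscrete_of_int {K : Type u} [Group K] {ρ : K →* Multiplicative ℝ} {c : K → ℤ}
    (hρ : ∀ z, (ρ z).toAdd = c z) : IsDiscrete ρ := by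
  have hcyc : IsCyclic (AddMonoidHom.toMultiplicative (Int.castAddHom ℝ)).range :=
    isCyclic_of_surjective _ (MonoidHom.rangeRestrict_surjective _)
  have hle : ρ.range ≤ (AddMonoidHom.toMultiplicative (Int.castAddHom ℝ)).range := by
    rintro _ ⟨z, rfl⟩
    exact ⟨Multiplicative.ofAdd (c z), Multiplicative.toAdd.injective (hρ z).symm⟩
  exact isCyclic_of_injective (Subgroup.inclusion hle) (Subgroup.inclusion_injective hle)

/-- A cobounded action on a tree that fixes an end, with Busemann character trivial on `H`. -/
theorem exists_character_of_fixesPoint {G : Type u} [Group G] {H Z : Subgroup G} [H.Normal]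
    (hHZ : H.IsComplement' Z) (hcomm : ∀ z z' : Z, z * z' = z' * z) {V : Type v}
    {X : SimpleGraph V} (hX : X.IsTree) {α : G →* (X ≃g X)} (hcob : IsCobounded α)
    {ξ : Boundary X} {x : V} {xs : ℕ → V} (hξ : FixesPoint α ξ) (hxs : ConvergesTo xs ξ)
    (hH : ∀ h ∈ H, busemann α x xs h = 0) :
    ∃ ρ : Z →* Multiplicative ℝ, ρ ≠ 1 ∧
      (∀ h ∈ H, ∀ z : Z, busemann α x xs (h * z) = (ρ z).toAdd) ∧
      IsDiscrete ρ ∧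
      ∃ w : V, IsConfining H Z ρ (vertexStabilizer α H w : Set G) ∧
        (IsOrientedLineal α → vertexStabilizer α H w = H) ∧
        (IsQuasiParabolic α → IsStrictlyConfining H Z ρ (vertexStabilizer α H w : Set G)) ∧
        ∀ C : ℝ, IsAdmissible ρ C →
          IsRepresentedBy ((vertexStabilizer α H w : Set G) ∪ slab ρ C) α ∧
          IsEquivariantlyQuasiIsometric
            (cayleyAction ((vertexStabilizer α H w : Set G) ∪ slab ρ C)) α := by
  obtain ⟨ht, hanc, hht⟩ := hxs.exists_isAncestral hX x
  have hP := hξ.apply_parent hX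
  obtain ⟨c, hc⟩ : ∃ c : G → ℤ, ∀ g v, ht (α g v) = ht v + c g :=
    ⟨fun g => ht (α g x) - ht x, hanc.exists_ht_map hP x⟩
  have hbus := busemann_eq hht hc
  have hcH : ∀ h ∈ H, c h = 0 := by
    intro h hh
    have h1 := hH h hh
    rw [hbus] at h1
    exact_mod_cast h1
  have hmul : ∀ g g', c (g * g') = c g + c g' := by
    intro g g'
    have h1 := hc (g * g') x
    rw [map_mul, RelIso.mul_apply, hc, hc] at h1
    omega
  have hinv : ∀ g, c g⁻¹ = - c g := by
    intro g
    have h1 := hmul g g⁻¹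
    have h2 := hmul 1 1
    rw [mul_inv_cancel] at h1
    rw [mul_one] at h2
    omega
  -- As `c` vanishes on `H`, its non-triviality is already visible on `Z`; an inverse fixes the
  -- sign.
  obtain ⟨b, hcb⟩ : ∃ b : Z, 0 < c b := by
    obtain ⟨g, hg⟩ := hanc.exists_ne_zero hc hcob
    obtain ⟨y, hy, z, rfl⟩ := exists_mul_eq hHZ g
    rw [hmul, hcH y hy, zero_add] at hg
    rcases lt_or_gt_of_ne hg with h1 | h1
    · exact ⟨z⁻¹, by rw [Subgroup.coe_inv, hinv]; omega⟩
    · exact ⟨z, h1⟩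
  obtain ⟨w, hw⟩ := hanc.exists_isAxial hP hc hcH
    (fun z hz z' hz' => congrArg Subtype.val (hcomm ⟨z, hz⟩ ⟨z', hz'⟩)) b.2 hcb x
  obtain ⟨ρ, hρ⟩ : ∃ ρ : Z →* Multiplicative ℝ, ∀ z : Z, (ρ z).toAdd = c z :=
    ⟨MonoidHom.mk' (fun z => Multiplicative.ofAdd (c z : ℝ)) (fun z z' => by
      rw [Subgroup.coe_mul, hmul, Int.cast_add, ofAdd_add]), fun z => rfl⟩
  refine ⟨ρ, ?_, ?_, isDiscrete_of_int hρ, w, hw.isConfining hρ b.2 hcb,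
    hw.vertexStabilizer_eq_of_isOrientedLineal hX b.2 hcb,
    hw.isStrictlyConfining hHZ hρ b.2 hcb, fun C hC =>
    hw.isRepresentedBy hHZ one_pos (fun z => by rw [hρ, one_mul]) hcob hC⟩
  · rintro rfl
    have h1 := hρ b
    rw [MonoidHom.one_apply, toAdd_one] at h1
    have h2 : c b = 0 := by exact_mod_cast h1.symm
    omega
  · intro h hh z
    rw [hbus, hρ, hmul, hcH h hh, zero_add]

end ConfTree

theorem mainTheorem10 :
    -- confining subgroups yield trees
    (∀ {G : Type*} [Group G] (H Z : Subgroup G) [H.Normal] (_ : H.IsComplement' Z)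
        (n : ℕ) (_ : Z ≃* Multiplicative (Fin n → ℤ))
        (ρ : Z →* Multiplicative ℝ), ρ ≠ 1 → IsDiscrete ρ →
        ∀ Q : Subgroup G, IsConfining H Z ρ (Q : Set G) →
        (∃ a : Z, IsMinimalPositive ρ a) ∧
        ∃ K : Subgroup G, (K : Set G) = (Q : Set G) * (kerIn ρ : Set G) ∧
          ∀ a : Z, IsMinimalPositive ρ a →
            IsAscendingHNN K (a : G) ∧ (bassSerre K (a : G)).IsTree ∧
            ∀ C : ℝ, IsAdmissible ρ C →
              IsRepresentedBy ((Q : Set G) ∪ slab ρ C) (bassSerreAction K (a : G))) ∧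
    -- trees yield confining subgroups
    (∀ {G : Type*} [Group G] (H Z : Subgroup G) [H.Normal] (_ : H.IsComplement' Z)
        (n : ℕ) (_ : Z ≃* Multiplicative (Fin n → ℤ))
        {V : Type*} (X : SimpleGraph V) (_ : X.IsTree) (α : G →* (X ≃g X)),
        IsCobounded α → (IsOrientedLineal α ∨ IsQuasiParabolic α) →
        ∀ (ξ : Boundary X) (x : V) (xs : ℕ → V), FixesPoint α ξ → ConvergesTo xs ξ →
        (∀ h ∈ H, busemann α x xs h = 0) →
        ∃ ρ : Z →* Multiplicative ℝ, ρ ≠ 1 ∧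
          (∀ h ∈ H, ∀ z : Z, busemann α x xs (h * z) = (ρ z).toAdd) ∧
          IsDiscrete ρ ∧
          ∃ w : V, IsConfining H Z ρ (vertexStabilizer α H w : Set G) ∧
            (IsOrientedLineal α → vertexStabilizer α H w = H) ∧
            (IsQuasiParabolic α → IsStrictlyConfining H Z ρ (vertexStabilizer α H w : Set G)) ∧
            ∀ C : ℝ, IsAdmissible ρ C →
              IsRepresentedBy ((vertexStabilizer α H w : Set G) ∪ slab ρ C) α ∧
              IsEquivariantlyQuasiIsometric
                (cayleyAction ((vertexStabilizer α H w : Set G) ∪ slab ρ C)) α) := by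
  refine ⟨?_, ?_⟩
  · intro G _ H Z _ hHZ n e ρ hρ hd Q hQ
    have hcomm : ∀ z z' : Z, z * z' = z' * z := fun z z' =>
      e.injective (by rw [map_mul, map_mul, mul_comm])
    exact ⟨exists_isMinimalPositive hρ hd, hQ.base, hQ.coe_base, fun a ha =>
      hQ.isAscendingHNN_isTree_isRepresentedBy hHZ hcomm ha⟩
  · intro G _ H Z _ hHZ n e V X hX α hcob _ ξ x xs hξ hxs hH
    have hcomm : ∀ z z' : Z, z * z' = z' * z := fun z z' =>
      e.injective (by rw [map_mul, map_mul, mul_comm])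
    exact exists_character_of_fixesPoint hHZ hcomm hX hcob hξ hxs hH
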